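/- Let $d\ge 1$ and let $m$ be Lebesgue measure on $\mathbb C^d\cong\mathbb R^{2d}$. Let $d\gamma(z)=(2\pi)^{-d}e^{-|z|^2/2}\,dm(z)$ and let $\mathcal F^2$ be the Bargmann space of entire functions on $\mathbb C^d$ that belong to $L^2(\mathbb C^d,\gamma)$. For a complex Borel measure $\mu$ with compact support in $\mathbb C^d$, the Toeplitz–Bargmann operator is $$(T_\mu^{\mathcal F}u)(z)=\int_{\mathbb C^d}u(w)\,e^{z\cdot\bar w/2}\,d\mu(w),\qquad u\in\mathcal F^2,\quad z\cdot\bar w=\sum_{j=1}^d z_j\bar w_j .$$ For a bounded connected open set $\Omega\subset\mathbb C^d$, let $H^2(\Omega)$ be the Bergman space of holomorphic functions in $L^2(\Omega,m)$ and let $B(z,w)$ be its Bergman kernel (the integral kernel of the orthogonal projection of $L^2(\Omega)$ onto $H^2(\Omega)$). For a complex Borel measure $\mu$ with compact support contained in $\Omega$, the Toeplitz–Bergman operator is $$(T_\mu^{\Omega}u)(z)=\int_{\Omega}u(w)\,B(z,w)\,d\mu(w),\qquad u\in H^2(\Omega).$$ Theorem. (i) Let $\mu$ be a (finite) complex Borel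 measure with compact support in $\mathbb C^d$. If $T_\mu^{\mathcal F}$ has finite rank $N$, then $\mu$ is a linear combination of exactly $N$ point masses: $\mu=\sum_{k=1}^N\lambda_k\delta_{z_k}$ with distinct points $z_k\in\mathbb C^d$ and coefficients $\lambda_k\in\mathbb C\setminus\{0\}$ (so $\mu=0$ if $N=0$). (ii) Let $\Omega\subset\mathbb C^d$ be a bounded connected open set and $\mu$ a (finite) complex Borel measure with compact support in $\Omega$. If $T_\mu^{\Omega}$ has finite rank $N$, then $\mu=\sum_{k=1}^N\lambda_k\delta_{z_k}$ with distinct points $z_k\in\Omega$ and coefficients $\lambda_k\in\mathbb C\setminus\{0\}$. In particular, in either case, if moreover $\mu$ is absolutely continuous with respect to Lebesgue measure, then $\mu=0$. -/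

import Mathlib

open MeasureTheory Set

noncomputable section

namespace Toeplitz

/-! ### Complex measures and integration against them -/

/-- `∫ f dμ` for a complex measure `μ`: the integral of Mathlib for vector measures, with
multiplication as the pairing. -/
def cintegral {X : Type*} [MeasurableSpace X] (μ : ComplexMeasure X) (f : X → ℂ) : ℂ :=
  VectorMeasure.integral μ f (ContinuousLinearMap.mul ℝ ℂ)

/-- A complex measure has finite total variation. -/
theorem isFiniteMeasure_variation {X : Type*} [MeasurableSpace X] (μ : ComplexMeasure X) :
    IsFiniteMeasure μ.variation := by
  have hle : μ.variation ≤ (ComplexMeasure.re μ).totalVariation +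
      (ComplexMeasure.im μ).totalVariation := by
    apply VectorMeasure.variation_le_of_forall_enorm_le
    intro E _
    calc ‖μ E‖ₑ = ‖((μ E).re : ℂ) + ((μ E).im : ℂ) * Complex.I‖ₑ := by rw [Complex.re_add_im]
      _ ≤ ‖((μ E).re : ℂ)‖ₑ + ‖((μ E).im : ℂ) * Complex.I‖ₑ := enorm_add_le _ _
      _ = ‖ComplexMeasure.re μ E‖ₑ + ‖ComplexMeasure.im μ E‖ₑ := by
          simp [enorm_eq_nnnorm, nnnorm_mul]
          rfl
      _ ≤ _ := add_le_add (SignedMeasure.enorm_le_totalVariation _ _)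
          (SignedMeasure.enorm_le_totalVariation _ _)
  exact isFiniteMeasure_of_le _ hle

theorem cintegral_add {X : Type*} [MeasurableSpace X] (μ : ComplexMeasure X) {f g : X → ℂ}
    (hf : Integrable f μ.variation) (hg : Integrable g μ.variation) :
    cintegral μ (fun x => f x + g x) = cintegral μ f + cintegral μ g :=
  VectorMeasure.integral_fun_add hf hg

theorem cintegral_const_mul {X : Type*} [MeasurableSpace X] (μ : ComplexMeasure X) (c : ℂ)
    (f : X → ℂ) : cintegral μ (fun x => c * f x) = c * cintegral μ f := by
  have h := setToFun_smul (𝕜 := ℂ)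
    (dominatedFinMeasAdditive_cbmApplyMeasure μ (ContinuousLinearMap.mul ℝ ℂ))
    (by
      intro c s x
      change (c • x) * μ s = c • (x * μ s)
      simp [mul_assoc]) c f
  exact h

/-- The complex measure `μ` is carried by a compact subset of `Ω`. -/
def HasCompactSupportIn {d : ℕ} (μ : ComplexMeasure (Fin d → ℂ)) (Ω : Set (Fin d → ℂ)) : Prop :=
  ∃ K : Set (Fin d → ℂ), IsCompact K ∧ K ⊆ Ω ∧
    ∀ A : Set (Fin d → ℂ), MeasurableSet A → Disjoint A K → μ A = 0

/-- `μ = ∑ cᵢ δ(zᵢ)` with exactly `N` distinct points `zᵢ`, all in `Ω`, and nonzero `cᵢ`. -/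
def IsCombOfPointMasses {d : ℕ} (N : ℕ) (Ω : Set (Fin d → ℂ))
    (μ : ComplexMeasure (Fin d → ℂ)) : Prop :=
  ∃ (z : Fin N → Fin d → ℂ) (c : Fin N → ℂ), Function.Injective z ∧ (∀ i, z i ∈ Ω) ∧
    (∀ i, c i ≠ 0) ∧ μ = ∑ i, VectorMeasure.dirac (z i) (c i)

/-! ### Hilbert spaces of holomorphic functions -/

/-- The holomorphic functions on `Ω` that are square integrable over `Ω` with respect to `ν`.
A function on `Ω` is represented by its extension by zero to `ℂ^d`. -/
def holL2 {d : ℕ} (Ω : Set (Fin d → ℂ)) (ν : Measure (Fin d → ℂ)) :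
    Submodule ℂ ((Fin d → ℂ) → ℂ) where
  carrier := {f | DifferentiableOn ℂ f Ω ∧ MemLp f 2 (ν.restrict Ω) ∧ ∀ z, z ∉ Ω → f z = 0}
  add_mem' := by
    rintro f g ⟨hf, hf', hf0⟩ ⟨hg, hg', hg0⟩
    exact ⟨hf.add hg, hf'.add hg', fun z hz => by simp [hf0 z hz, hg0 z hz]⟩
  zero_mem' := ⟨differentiableOn_const 0, MemLp.zero', fun _ _ => rfl⟩
  smul_mem' := by
    rintro c f ⟨hf, hf', hf0⟩
    exact ⟨hf.const_smul c, hf'.const_smul c, fun z hz => by simp [hf0 z hz]⟩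

/-- The Gaussian measure `dγ(z) = (2π)^{-d} e^{-|z|²/2} dm(z)` on `ℂ^d`. -/
def gaussian (d : ℕ) : Measure (Fin d → ℂ) :=
  volume.withDensity fun z =>
    ENNReal.ofReal (((2 * Real.pi) ^ d)⁻¹ * Real.exp (-(∑ j, ‖z j‖ ^ 2) / 2))

/-- The Bargmann (Fock) space of entire functions in `L²(γ)`. -/
def bargmannSpace (d : ℕ) : Submodule ℂ ((Fin d → ℂ) → ℂ) := holL2 univ (gaussian d)

/-- The Bergman space of holomorphic functions in `L²(Ω)`. -/
def bergmanSpace {d : ℕ} (Ω : Set (Fin d → ℂ)) : Submodule ℂ ((Fin d → ℂ) → ℂ) :=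
  holL2 Ω volume

/-- The kernel `P(z, w) = exp(z·w̄ / 2)` of the orthogonal projection of `L²(γ)` onto the
Bargmann space. -/
def bargmannKernel {d : ℕ} (z w : Fin d → ℂ) : ℂ :=
  Complex.exp ((∑ j, z j * (starRingEnd ℂ) (w j)) / 2)

/-- `k` is the element of the Bergman space of `Ω` that represents evaluation at `z`:
`u(z) = ∫_Ω u k̄ dm` for all `u` in the Bergman space. -/
def IsReproducingAt {d : ℕ} (Ω : Set (Fin d → ℂ)) (z : Fin d → ℂ) (k : (Fin d → ℂ) → ℂ) : Prop :=
  k ∈ bergmanSpace Ω ∧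
    ∀ u ∈ bergmanSpace Ω, u z = ∫ w in Ω, u w * (starRingEnd ℂ) (k w)

/-- For `Ω` open, such a `k` is unique. -/
theorem IsReproducingAt.unique {d : ℕ} {Ω : Set (Fin d → ℂ)} (hΩ : IsOpen Ω) {z : Fin d → ℂ}
    {k l : (Fin d → ℂ) → ℂ} (hk : IsReproducingAt Ω z k) (hl : IsReproducingAt Ω z l) : k = l := by
  have hg : k - l ∈ bergmanSpace Ω := Submodule.sub_mem _ hk.1 hl.1
  have hint : ∀ u ∈ bergmanSpace Ω, IntegrableOn
      (fun w => (k - l) w * (starRingEnd ℂ) (u w)) Ω := by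
    intro u hu
    exact MemLp.integrable_mul (p := 2) (q := 2) hg.2.1 hu.2.1.star
  have h0 : ∫ w in Ω, (k - l) w * (starRingEnd ℂ) ((k - l) w) = 0 := by
    have h := (hk.2 _ hg).symm.trans (hl.2 _ hg)
    have h1 := integral_sub (hint k hk.1) (hint l hl.1)
    rw [h, sub_self] at h1
    rw [← h1]
    congr 1
    funext w
    simp [mul_sub]
  have h1 : ∫ w in Ω, ‖(k - l) w‖ ^ 2 = 0 := by
    have : (fun w => (k - l) w * (starRingEnd ℂ) ((k - l) w)) =
        fun w => ((‖(k - l) w‖ ^ 2 : ℝ) : ℂ) := by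
      funext w
      rw [Complex.mul_conj, Complex.normSq_eq_norm_sq]
    rw [this, integral_complex_ofReal] at h0
    exact_mod_cast h0
  have hi : IntegrableOn (fun w => ‖(k - l) w‖ ^ 2) Ω := hg.2.1.integrable_norm_pow (by norm_num)
  rw [integral_eq_zero_iff_of_nonneg (fun w => by positivity) hi] at h1
  have hz : EqOn (k - l) 0 Ω := by
    refine Measure.eqOn_open_of_ae_eq (μ := volume) ?_ hΩ hg.1.continuousOn continuousOn_const
    filter_upwards [h1] with w hw
    simpa using hw
  funext w
  by_cases hw : w ∈ Ω
  · exact sub_eq_zero.1 (hz hw)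
  · rw [hk.1.2.2 w hw, hl.1.2.2 w hw]

open Classical in
/-- The function `k_z` of the Bergman space of `Ω` that represents evaluation at `z` (it exists
for every open `Ω`, by the Riesz theorem). -/
def reproducingElement {d : ℕ} (Ω : Set (Fin d → ℂ)) (z : Fin d → ℂ) : (Fin d → ℂ) → ℂ :=
  if h : ∃ k, IsReproducingAt Ω z k then h.choose else 0

/-- The Bergman kernel `B(z, w)` of `Ω`, the integral kernel of the orthogonal projection
`L²(Ω) → H²(Ω)`, that is, `(Pf)(z) = ⟨f, k_z⟩ = ∫_Ω B(z, w) f(w) dm(w)` with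
`B(z, w) = conj (k_z(w))`. -/
def bergmanKernel {d : ℕ} (Ω : Set (Fin d → ℂ)) (z w : Fin d → ℂ) : ℂ :=
  (starRingEnd ℂ) (reproducingElement Ω z w)

theorem continuous_bargmannKernel {d : ℕ} (z : Fin d → ℂ) : Continuous (bargmannKernel z) := by
  unfold bargmannKernel
  fun_prop

theorem continuousOn_bergmanKernel {d : ℕ} (Ω : Set (Fin d → ℂ)) (z : Fin d → ℂ) :
    ContinuousOn (bergmanKernel Ω z) Ω := by
  have h : ContinuousOn (reproducingElement Ω z) Ω := by
    unfold reproducingElement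
    split_ifs with h
    · exact h.choose_spec.1.1.continuousOn
    · exact continuousOn_const
  exact Complex.continuous_conj.comp_continuousOn h

/-! ### Toeplitz operators -/

theorem integrable_of_continuousOn {d : ℕ} {Ω : Set (Fin d → ℂ)}
    {μ : ComplexMeasure (Fin d → ℂ)} (hμ : HasCompactSupportIn μ Ω) {f : (Fin d → ℂ) → ℂ}
    (hf : ContinuousOn f Ω) : Integrable f μ.variation := by
  obtain ⟨K, hK, hKΩ, h0⟩ := hμ
  have := isFiniteMeasure_variation μ
  have hz : μ.variation Kᶜ = 0 := by
    rw [VectorMeasure.variation_apply_eq_zero hK.measurableSet.compl]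
    intro t ht htm
    exact h0 t htm (disjoint_compl_left_iff_subset.2 le_rfl |>.mono_left ht)
  have hi : IntegrableOn f K μ.variation := (hf.mono hKΩ).integrableOn_compact hK
  have hr : μ.variation.restrict K = μ.variation :=
    Measure.restrict_eq_self_of_ae_mem (by
      rw [ae_iff]
      exact hz)
  rwa [IntegrableOn, hr] at hi

/-- The operator `(T u)(z) = ∫ u(w) Q(z, w) dμ(w)`, `u ∈ holL2 Ω ν`, with kernel `Q`. For the two
kernels below its values lie in `holL2 Ω ν` again; they are recorded here as functions on `ℂ^d`,
which does not affect the rank. -/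
def toeplitz {d : ℕ} (Ω : Set (Fin d → ℂ)) (ν : Measure (Fin d → ℂ))
    (Q : (Fin d → ℂ) → (Fin d → ℂ) → ℂ) (hQ : ∀ z, ContinuousOn (Q z) Ω)
    (μ : ComplexMeasure (Fin d → ℂ)) (hμ : HasCompactSupportIn μ Ω) :
    holL2 Ω ν →ₗ[ℂ] ((Fin d → ℂ) → ℂ) where
  toFun u := fun z => cintegral μ fun w => (u : (Fin d → ℂ) → ℂ) w * Q z w
  map_add' u v := by
    funext z
    have hu := integrable_of_continuousOn hμ (u.2.1.continuousOn.mul (hQ z))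
    have hv := integrable_of_continuousOn hμ (v.2.1.continuousOn.mul (hQ z))
    have h := cintegral_add μ hu hv
    have e : (fun w => ((u + v : holL2 Ω ν) : (Fin d → ℂ) → ℂ) w * Q z w) =
        fun w => (u : (Fin d → ℂ) → ℂ) w * Q z w + (v : (Fin d → ℂ) → ℂ) w * Q z w := by
      funext w
      exact add_mul _ _ _
    rw [e]
    exact h
  map_smul' c u := by
    funext z
    have h := cintegral_const_mul μ c fun w => (u : (Fin d → ℂ) → ℂ) w * Q z w
    simpa [mul_assoc] using h

/-- The Toeplitz–Bargmann operator `(T_μ u)(z) = ∫ u(w) P(z, w) dμ(w)` on the Bargmann space. -/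
def toeplitzBargmann {d : ℕ} (μ : ComplexMeasure (Fin d → ℂ)) (hμ : HasCompactSupportIn μ univ) :
    bargmannSpace d →ₗ[ℂ] ((Fin d → ℂ) → ℂ) :=
  toeplitz univ (gaussian d) bargmannKernel
    (fun z => (continuous_bargmannKernel z).continuousOn) μ hμ

/-- The Toeplitz–Bergman operator `(T_μ u)(z) = ∫ u(w) B(z, w) dμ(w)` on the Bergman space of
`Ω`. -/
def toeplitzBergman {d : ℕ} (Ω : Set (Fin d → ℂ)) (μ : ComplexMeasure (Fin d → ℂ))
    (hμ : HasCompactSupportIn μ Ω) : bergmanSpace Ω →ₗ[ℂ] ((Fin d → ℂ) → ℂ) :=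
  toeplitz Ω volume (bergmanKernel Ω) (continuousOn_bergmanKernel Ω) μ hμ

end Toeplitz

end

/-! Suppose the operator has rank `N`, and let `A` be an algebra of entire functions whose
restrictions lie in its domain. Any `N + 1` functions `fᵢ ∈ A` have a nontrivial combination `u`
with `T u = 0`, and this forces `∫ u ḡ dμ = 0` for every `g ∈ A`. Hence all matrices `∫ fᵢ ḡⱼ dμ` of
size `N + 1` are singular. By Andréief's identity this says that `det fᵢ(xⱼ) · conj (det gᵢ(xⱼ))`
has integral zero against the product measure `μ^(N+1)` (`integral_det_mul_det_eq_zero`).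

Write `D = det fᵢ(xⱼ)`. Taking `p fᵢ` and `q fᵢ` as the two families shows that `|D|² dμ^(N+1)`
annihilates every `∏ p(xᵢ) · conj (∏ q(xᵢ))`. These functions span a self-adjoint algebra that
separates tuples up to permutation, so by Stone–Weierstrass (`exists_mem_span_near`) all symmetric
continuous functions are annihilated. The measure being symmetric itself, it vanishes
(`ae_det_mul_eq_zero`). If the support of `|μ|` had `N + 1` distinct points, functions `fᵢ` dual to
them would make `D` nonzero nearby, a contradiction. So `μ` is a combination of `M ≤ N` point
masses; its operator has rank at most `M`, whence `M = N`.

For `A` one takes the span of the exponentials of linear forms, which are square integrable in both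
settings. In the Bargmann space their conjugates are themselves kernel functions; in the Bergman
space the orthogonality to `A` comes from the Riesz theorem (`cintegral_mul_conj_eq_zero`). -/

namespace Toeplitz

/-! ### Symmetric products over a point-separating algebra, and Stone–Weierstrass. -/

section Separation

variable {E : Type*} {A : Subalgebra ℂ (E → ℂ)}

/-- A point-separating algebra of functions contains an element that is `1` at `a` and vanishes
at finitely many other given points. -/
theorem exists_mem_eq_one_and_eq_zero (hsep : ∀ x y : E, x ≠ y → ∃ f ∈ A, f x ≠ f y)
    (s : Finset E) (a : E) : ∃ p ∈ A, p a = 1 ∧ ∀ b ∈ s, b ≠ a → p b = 0 := by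
  classical
  have h : ∀ b : E, ∃ p ∈ A, p a = 1 ∧ (b ≠ a → p b = 0) := by
    intro b
    by_cases hb : b = a
    · exact ⟨1, A.one_mem, rfl, fun h => absurd hb h⟩
    · obtain ⟨f, hf, hne⟩ := hsep a b (Ne.symm hb)
      refine ⟨(f a - f b)⁻¹ • (f - algebraMap ℂ (E → ℂ) (f b)),
        A.smul_mem (A.sub_mem hf (A.algebraMap_mem _)) _, ?_, fun _ => ?_⟩
      · simp [inv_mul_cancel₀ (sub_ne_zero.2 hne)]
      · simp
  choose p hpA hpa hpb using h
  refine ⟨∏ b ∈ s, p b, A.prod_mem fun b _ => hpA b, ?_, fun b hb hne => ?_⟩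
  · simp [Finset.prod_apply, hpa]
  · rw [Finset.prod_apply]
    exact Finset.prod_eq_zero hb (hpb b hne)

/-- The functions `x ↦ ∏ p (x i)` with `p` in a point-separating algebra distinguish tuples that
are not permutations of each other. -/
theorem exists_perm_of_prod_eq (hsep : ∀ x y : E, x ≠ y → ∃ f ∈ A, f x ≠ f y)
    {ι : Type*} [Fintype ι] {x y : ι → E} (h : ∀ p ∈ A, ∏ i, p (x i) = ∏ i, p (y i)) :
    ∃ σ : Equiv.Perm ι, ∀ i, y (σ i) = x i := by
  classical
  have hcard : ∀ a : E, Nonempty ({i // x i = a} ≃ {i // y i = a}) := by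
    intro a
    obtain ⟨p, hp, hpa, hpb⟩ := exists_mem_eq_one_and_eq_zero hsep
      (Finset.univ.image x ∪ Finset.univ.image y) a
    -- `1 + p` is 2 at entries equal to `a` and 1 at the others, so the product records the
    -- multiplicity of `a` in the tuple.
    have key : ∀ z : ι → E, (∀ i, z i ∈ Finset.univ.image x ∪ Finset.univ.image y) →
        ∏ i, (1 + p) (z i) = (2 : ℂ) ^ Fintype.card {i // z i = a} := by
      intro z hz
      have : ∀ i, (1 + p) (z i) = if z i = a then (2 : ℂ) else 1 := by
        intro i
        split_ifs with hi
        · simp [hi, hpa]; norm_num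
        · simp [hpb _ (hz i) hi]
      simp_rw [this]
      rw [Finset.prod_ite, Finset.prod_const, Finset.prod_const_one, mul_one,
        Fintype.card_subtype]
    have h2 := h (1 + p) (A.add_mem A.one_mem hp)
    rw [key x (by simp), key y (by simp)] at h2
    rw [← Fintype.card_eq]
    have h3 : (2 : ℕ) ^ Fintype.card {i // x i = a} = 2 ^ Fintype.card {i // y i = a} := by
      exact_mod_cast h2
    exact Nat.pow_right_injective le_rfl h3
  exact ⟨Equiv.ofFiberEquiv fun a => (hcard a).some, fun i => Equiv.ofFiberEquiv_map _ i⟩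

variable [TopologicalSpace E]

/-- Symmetric continuous functions on `K^ι` are uniform limits of linear combinations of the
functions `x ↦ ∏ p (x i) * conj (∏ q (x i))`. -/
theorem exists_mem_span_near (hsep : ∀ x y : E, x ≠ y → ∃ f ∈ A, f x ≠ f y)
    (hc : ∀ f ∈ A, Continuous f) {ι : Type*} [Fintype ι] {K : Set E} (hK : IsCompact K)
    {φ : (ι → E) → ℂ} (hφ : Continuous φ)
    (hsymm : ∀ (σ : Equiv.Perm ι) (x : ι → E), φ (fun i => x (σ i)) = φ x) {ε : ℝ} (hε : 0 < ε) :
    ∃ h ∈ Submodule.span ℂ {w : (ι → E) → ℂ | ∃ p ∈ A, ∃ q ∈ A,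
        w = fun x => (∏ i, p (x i)) * (starRingEnd ℂ) (∏ i, q (x i))},
      ∀ x ∈ univ.pi (fun _ : ι => K), ‖φ x - h x‖ < ε := by
  set W : Set ((ι → E) → ℂ) := {w : (ι → E) → ℂ | ∃ p ∈ A, ∃ q ∈ A,
        w = fun x => (∏ i, p (x i)) * (starRingEnd ℂ) (∏ i, q (x i))} with hW
  let X := ↥(univ.pi (fun _ : ι => K))
  have : CompactSpace X := isCompact_iff_compactSpace.1 (isCompact_univ_pi fun _ => hK)
  -- Stone–Weierstrass is applied on the quotient of `K^ι` by equality of all the products, where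
  -- point separation holds by construction. The conjugated factor in `W` makes the span closed
  -- under `star`.
  let F : X → A → ℂ := fun x p => ∏ i, (p : E → ℂ) ((x : ι → E) i)
  let s : Setoid X := Setoid.ker F
  let Y := Quotient s
  have hmul : ∀ a ∈ Submodule.span ℂ W, ∀ b ∈ Submodule.span ℂ W, a * b ∈ Submodule.span ℂ W := by
    intro a ha b hb
    have := Submodule.mul_mem_mul ha hb
    rw [Submodule.span_mul_span] at this
    refine Submodule.span_mono ?_ this
    rintro _ ⟨_, ⟨p, hp, q, hq, rfl⟩, _, ⟨p', hp', q', hq', rfl⟩, rfl⟩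
    refine ⟨p * p', A.mul_mem hp hp', q * q', A.mul_mem hq hq', ?_⟩
    funext x
    simp only [Pi.mul_apply, Finset.prod_mul_distrib, map_mul]
    ring
  have hstar : ∀ a ∈ Submodule.span ℂ W, star a ∈ Submodule.span ℂ W := by
    intro a ha
    induction ha using Submodule.span_induction with
    | mem w hw =>
      obtain ⟨p, hp, q, hq, rfl⟩ := hw
      refine Submodule.subset_span ⟨q, hq, p, hp, ?_⟩
      funext x
      simp [mul_comm]
    | zero => simp
    | add a b _ _ ha hb => rw [star_add]; exact Submodule.add_mem _ ha hb
    | smul c a _ ha => rw [star_smul]; exact Submodule.smul_mem _ _ ha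
  have halg : ∀ c : ℂ, (algebraMap ℂ ((ι → E) → ℂ) c) ∈ Submodule.span ℂ W := by
    intro c
    rw [Algebra.algebraMap_eq_smul_one]
    refine Submodule.smul_mem _ _ (Submodule.subset_span ⟨1, A.one_mem, 1, A.one_mem, ?_⟩)
    funext x
    simp
  let S : StarSubalgebra ℂ C(Y, ℂ) :=
    { carrier := {h | ∃ H ∈ Submodule.span ℂ W, ∀ x : X, h (Quotient.mk s x) = H x}
      mul_mem' := by
        rintro a b ⟨H, hH, h1⟩ ⟨G, hG, h2⟩
        exact ⟨H * G, hmul _ hH _ hG, fun x => by simp [h1, h2]⟩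
      add_mem' := by
        rintro a b ⟨H, hH, h1⟩ ⟨G, hG, h2⟩
        exact ⟨H + G, Submodule.add_mem _ hH hG, fun x => by simp [h1, h2]⟩
      algebraMap_mem' := fun c => ⟨_, halg c, fun x => by simp⟩
      star_mem' := by
        rintro a ⟨H, hH, h1⟩
        exact ⟨star H, hstar _ hH, fun x => by simp [h1]⟩ }
  have hS : S.SeparatesPoints := by
    intro a b
    induction a using Quotient.inductionOn with | h x => ?_
    induction b using Quotient.inductionOn with | h y => ?_
    intro hne
    have hF : F x ≠ F y := fun h => hne (Quotient.sound h)
    obtain ⟨p, hp⟩ := Function.ne_iff.1 hF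
    have hcont : Continuous fun z : X => F z p := by
      refine continuous_finsetProd _ fun i _ => ?_
      exact (hc p p.2).comp ((continuous_apply i).comp continuous_subtype_val)
    let f : C(Y, ℂ) := ⟨Quotient.lift (fun z : X => F z p) fun a b hab => congrFun hab p,
      hcont.quotient_lift _⟩
    refine ⟨f, ⟨f, ⟨fun x => ∏ i, (p : E → ℂ) (x i), Submodule.subset_span
      ⟨p, p.2, 1, A.one_mem, by funext x; simp⟩, fun x => rfl⟩, rfl⟩, hp⟩
  -- Tuples in one class are permutations of each other, so a symmetric function descends to the
  -- quotient.
  let φ' : C(Y, ℂ) := ⟨Quotient.lift (fun z : X => φ z) fun a b hab => by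
    obtain ⟨σ, hσ⟩ := exists_perm_of_prod_eq hsep (x := (a : ι → E)) (y := (b : ι → E))
      fun p hp => congrFun hab ⟨p, hp⟩
    have : (a : ι → E) = fun i => (b : ι → E) (σ i) := funext fun i => (hσ i).symm
    change φ a = φ b
    rw [this, hsymm], (hφ.comp continuous_subtype_val).quotient_lift _⟩
  have hmem : φ' ∈ S.topologicalClosure := by
    rw [ContinuousMap.starSubalgebra_topologicalClosure_eq_top_of_separatesPoints S hS]
    trivial
  rw [← SetLike.mem_coe, StarSubalgebra.topologicalClosure_coe, Metric.mem_closure_iff] at hmem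
  obtain ⟨h, ⟨H, hH, hh⟩, hdist⟩ := hmem ε hε
  refine ⟨H, hH, fun x hx => ?_⟩
  have := ContinuousMap.dist_apply_le_dist (f := φ') (g := h) (Quotient.mk s ⟨x, hx⟩)
  rw [hh, dist_eq_norm] at this
  exact this.trans_lt hdist

end Separation

end Toeplitz

namespace Toeplitz

theorem ae_pi_mem {E ι : Type*} [MeasurableSpace E] [Fintype ι] {ν : Measure E} [SigmaFinite ν] {K : Set E} (hνK : ∀ᵐ x ∂ν, x ∈ K) :
    ∀ᵐ x ∂(Measure.pi fun _ : ι => ν), x ∈ univ.pi fun _ : ι => K := by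
  have h : ∀ i : ι, ∀ᵐ x ∂(Measure.pi fun _ : ι => ν), x i ∈ K := fun i =>
    (Measure.tendsto_eval_ae_ae (μ := fun _ : ι => ν) (i := i)).eventually hνK
  filter_upwards [ae_all_iff.2 h] with x hx i _ using hx i

/-! ### Andréief's identity for determinants of integrals. -/

section Determinant

variable {E : Type*} [MeasurableSpace E] {ι : Type*} [Fintype ι] [DecidableEq ι]

/-- The determinant of a matrix of integrals as an integral over the product space. -/
theorem det_integral_eq {ν : Measure E} [SigmaFinite ν] {ρ : E → ℂ} {f g : ι → E → ℂ}
    (hint : ∀ i j, Integrable (fun w => f i w * g j w * ρ w) ν) :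
    (Matrix.of fun i j => ∫ w, f i w * g j w * ρ w ∂ν).det =
      ∫ x : ι → E, (Matrix.of fun i j => f i (x j)).det * ((∏ i, g i (x i)) * ∏ i, ρ (x i))
        ∂(Measure.pi fun _ => ν) := by
  -- Only one determinant is expanded: each Leibniz term is then a product of functions of one
  -- variable, to which Fubini applies.
  have h1 : ∀ x : ι → E, (Matrix.of fun i j => f i (x j)).det *
      ((∏ i, g i (x i)) * ∏ i, ρ (x i)) = ∑ σ : Equiv.Perm ι,
        (Equiv.Perm.sign σ : ℂ) * ∏ i, (f (σ i) (x i) * g i (x i) * ρ (x i)) := by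
    intro x
    rw [Matrix.det_apply', Finset.sum_mul]
    refine Finset.sum_congr rfl fun σ _ => ?_
    simp only [Matrix.of_apply, Finset.prod_mul_distrib]
    ring
  simp_rw [h1]
  rw [integral_finsetSum, Matrix.det_apply']
  · refine Finset.sum_congr rfl fun σ _ => ?_
    rw [integral_const_mul]
    congr 1
    exact (integral_fintype_prod_eq_prod fun i w => f (σ i) w * g i w * ρ w).symm
  · intro σ _
    exact (Integrable.fintype_prod fun i => hint (σ i) i).const_mul _

/-- The antisymmetrized form of `det_integral_eq` when all the determinants vanish. -/
theorem integral_det_mul_det_eq_zero {ν : Measure E} [SigmaFinite ν] {ρ : E → ℂ} {f g : ι → E → ℂ}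
    (hint : ∀ i j, Integrable (fun w => f i w * g j w * ρ w) ν)
    (hdet : (Matrix.of fun i j => ∫ w, f i w * g j w * ρ w ∂ν).det = 0) :
    ∫ x : ι → E, (Matrix.of fun i j => f i (x j)).det * (Matrix.of fun i j => g i (x j)).det *
      ∏ i, ρ (x i) ∂(Measure.pi fun _ => ν) = 0 := by
  have h1 : ∀ x : ι → E, (Matrix.of fun i j => f i (x j)).det *
      (Matrix.of fun i j => g i (x j)).det * ∏ i, ρ (x i) = ∑ σ : Equiv.Perm ι,
        (Equiv.Perm.sign σ : ℂ) * ((Matrix.of fun i j => f i (x j)).det *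
          ((∏ i, g (σ i) (x i)) * ∏ i, ρ (x i))) := by
    intro x
    rw [Matrix.det_apply' (Matrix.of fun i j => g i (x j)), Finset.mul_sum, Finset.sum_mul]
    refine Finset.sum_congr rfl fun σ _ => ?_
    simp only [Matrix.of_apply]
    ring
  -- Permuting the `g j` permutes columns and changes the determinant only by a sign.
  have h2 : ∀ σ : Equiv.Perm ι,
      (Matrix.of fun i j => ∫ w, f i w * g (σ j) w * ρ w ∂ν).det = 0 := by
    intro σ
    have := Matrix.det_permute' σ (Matrix.of fun i j => ∫ w, f i w * g j w * ρ w ∂ν)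
    rw [hdet, mul_zero] at this
    exact this
  simp_rw [h1]
  rw [integral_finsetSum]
  · refine Finset.sum_eq_zero fun σ _ => ?_
    rw [integral_const_mul, ← det_integral_eq (g := fun i => g (σ i)) fun i j => hint i (σ j), h2 σ,
      mul_zero]
  · intro σ _
    refine Integrable.const_mul ?_ _
    have h3 : ∀ x : ι → E, (Matrix.of fun i j => f i (x j)).det *
      ((∏ i, g (σ i) (x i)) * ∏ i, ρ (x i)) = ∑ τ : Equiv.Perm ι,
        (Equiv.Perm.sign τ : ℂ) * ∏ i, (f (τ i) (x i) * g (σ i) (x i) * ρ (x i)) := by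
      intro x
      rw [Matrix.det_apply', Finset.sum_mul]
      refine Finset.sum_congr rfl fun τ _ => ?_
      simp only [Matrix.of_apply, Finset.prod_mul_distrib]
      ring
    simp_rw [h3]
    exact integrable_finsetSum _ fun τ _ =>
      (Integrable.fintype_prod fun i => hint (τ i) (σ i)).const_mul _

theorem integrable_mul_of_continuous [TopologicalSpace E] [OpensMeasurableSpace E]
    {ν : Measure E} {K : Set E} (hK : IsCompact K)
    (hνK : ∀ᵐ x ∂ν, x ∈ K) {r : E → ℂ} (hr : Integrable r ν) {f : E → ℂ} (hf : Continuous f) :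
    Integrable (fun x => f x * r x) ν := by
  obtain ⟨C, hC⟩ := hK.exists_bound_of_continuousOn hf.continuousOn
  refine hr.bdd_mul (c := C) hf.measurable.aestronglyMeasurable ?_
  filter_upwards [hνK] with x hx using hC x hx

end Determinant

/-! ### Vanishing of the alternants and finiteness of the support. -/

section Vanishing

variable {E : Type*} [NormedAddCommGroup E] [NormedSpace ℝ E] [FiniteDimensional ℝ E]
  [MeasurableSpace E] [BorelSpace E] [SecondCountableTopology E] {A : Subalgebra ℂ (E → ℂ)}
  {ι : Type*} [Fintype ι] [DecidableEq ι]

/-- If all matrices `∫ fᵢ conj(gⱼ) ρ dν` of a fixed size over a point-separating algebra are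
singular, then the alternants `det fᵢ(xⱼ)` vanish almost everywhere. -/
theorem ae_det_mul_eq_zero {ν : Measure E} [IsFiniteMeasure ν] {K : Set E} (hK : IsCompact K)
    (hνK : ∀ᵐ x ∂ν, x ∈ K) {ρ : E → ℂ} (hρ : Integrable ρ ν)
    (hsep : ∀ x y : E, x ≠ y → ∃ f ∈ A, f x ≠ f y) (hc : ∀ f ∈ A, Continuous f)
    (hdet : ∀ f g : ι → E → ℂ, (∀ i, f i ∈ A) → (∀ i, g i ∈ A) →
      (Matrix.of fun i j => ∫ w, f i w * (starRingEnd ℂ) (g j w) * ρ w ∂ν).det = 0)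
    {f : ι → E → ℂ} (hf : ∀ i, f i ∈ A) :
    ∀ᵐ x ∂(Measure.pi fun _ : ι => ν),
      (Matrix.of fun i j => f i (x j)).det * (starRingEnd ℂ) (Matrix.of fun i j => f i (x j)).det *
        ∏ i, ρ (x i) = 0 := by
  set D : (ι → E) → ℂ := fun x => (Matrix.of fun i j => f i (x j)).det with hD
  set Φ : (ι → E) → ℂ := fun x => D x * (starRingEnd ℂ) (D x) * ∏ i, ρ (x i) with hΦ
  set P : Measure (ι → E) := Measure.pi fun _ : ι => ν with hP
  have hKpi : IsCompact (univ.pi fun _ : ι => K) := isCompact_univ_pi fun _ => hK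
  have hPK : ∀ᵐ x ∂P, x ∈ univ.pi fun _ : ι => K := ae_pi_mem hνK
  have hDc : Continuous D := by
    refine Continuous.matrix_det (continuous_matrix fun i j => ?_)
    exact (hc _ (hf i)).comp (continuous_apply j)
  have hDconj : Continuous fun x => D x * (starRingEnd ℂ) (D x) :=
    hDc.mul (Complex.continuous_conj.comp hDc)
  have hΦint : Integrable Φ P :=
    integrable_mul_of_continuous hKpi hPK (Integrable.fintype_prod fun _ => hρ) hDconj
  have hmulint : ∀ {φ : (ι → E) → ℂ}, Continuous φ → Integrable (fun x => φ x * Φ x) P :=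
    fun h => integrable_mul_of_continuous hKpi hPK hΦint h
  have hprod : ∀ p ∈ A, Continuous fun x : ι → E => ∏ i, p (x i) := fun p hp =>
    continuous_finsetProd _ fun i _ => (hc p hp).comp (continuous_apply i)
  -- test functions of product type
  have hW : ∀ p ∈ A, ∀ q ∈ A,
      ∫ x, ((∏ i, p (x i)) * (starRingEnd ℂ) (∏ i, q (x i))) * Φ x ∂P = 0 := by
    intro p hp q hq
    -- The same `f` enters both families, so that `p` and `q` factor out of the determinants and the
    -- permutation-invariant weight `|D|²` remains.
    have h := integral_det_mul_det_eq_zero (ν := ν) (ρ := ρ) (f := fun i => p * f i)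
      (g := fun i w => (starRingEnd ℂ) ((q * f i) w)) (fun i j => by
        refine integrable_mul_of_continuous hK hνK hρ ?_
        exact (hc _ (A.mul_mem hp (hf i))).mul
          (Complex.continuous_conj.comp (hc _ (A.mul_mem hq (hf j)))))
      (hdet _ _ (fun i => A.mul_mem hp (hf i)) fun i => A.mul_mem hq (hf i))
    rw [← h]
    refine integral_congr_ae (Filter.Eventually.of_forall fun x => ?_)
    have e1 : (Matrix.of fun i j => (p * f i) (x j)).det = (∏ i, p (x i)) * D x :=
      Matrix.det_mul_row (fun j => p (x j)) (Matrix.of fun i j => f i (x j))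
    have e2 : (Matrix.of fun i j => (starRingEnd ℂ) ((q * f i) (x j))).det =
        (starRingEnd ℂ) ((∏ i, q (x i)) * D x) := by
      rw [← Matrix.det_mul_row (fun j => q (x j)) (Matrix.of fun i j => f i (x j)),
        RingHom.map_det]
      rfl
    simp only [e1, e2, hΦ, map_mul]
    ring
  have hspan : ∀ h ∈ Submodule.span ℂ {w : (ι → E) → ℂ | ∃ p ∈ A, ∃ q ∈ A,
        w = fun x => (∏ i, p (x i)) * (starRingEnd ℂ) (∏ i, q (x i))},
      Continuous h ∧ ∫ x, h x * Φ x ∂P = 0 := by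
    intro h hh
    induction hh using Submodule.span_induction with
    | mem w hw =>
      obtain ⟨p, hp, q, hq, rfl⟩ := hw
      exact ⟨(hprod p hp).mul (Complex.continuous_conj.comp (hprod q hq)), hW p hp q hq⟩
    | zero => exact ⟨continuous_const, by simp⟩
    | add a b _ _ ha hb =>
      refine ⟨ha.1.add hb.1, ?_⟩
      simp only [Pi.add_apply, add_mul]
      rw [integral_add (hmulint ha.1) (hmulint hb.1), ha.2, hb.2, add_zero]
    | smul c a _ ha =>
      refine ⟨ha.1.const_smul c, ?_⟩
      simp only [Pi.smul_apply, smul_eq_mul, mul_assoc]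
      rw [integral_const_mul, ha.2, mul_zero]
  -- symmetric test functions
  have hsymm : ∀ φ : (ι → E) → ℂ, Continuous φ →
      (∀ (σ : Equiv.Perm ι) (x : ι → E), φ (fun i => x (σ i)) = φ x) →
      ∫ x, φ x * Φ x ∂P = 0 := by
    intro φ hφ hs
    set C := ∫ x, ‖Φ x‖ ∂P with hC
    have hC0 : 0 ≤ C := integral_nonneg fun _ => norm_nonneg _
    have key : ∀ ε > 0, ‖∫ x, φ x * Φ x ∂P‖ ≤ ε * C := by
      intro ε hε
      obtain ⟨h, hh, hle⟩ := exists_mem_span_near hsep hc hK hφ hs hε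
      obtain ⟨hhc, hh0⟩ := hspan h hh
      have e : ∫ x, φ x * Φ x ∂P = ∫ x, (φ x - h x) * Φ x ∂P := by
        simp only [sub_mul]
        rw [integral_sub (hmulint hφ) (hmulint hhc), hh0, sub_zero]
      rw [e, hC, ← integral_const_mul]
      refine norm_integral_le_of_norm_le (hΦint.norm.const_mul _) ?_
      filter_upwards [hPK] with x hx
      rw [norm_mul]
      exact mul_le_mul_of_nonneg_right (hle x hx).le (norm_nonneg _)
    rw [← norm_le_zero_iff]
    refine le_of_forall_pos_le_add fun ε hε => ?_
    -- `C + 1` rather than `C`, which may be zero.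
    refine (key (ε / (C + 1)) (by positivity)).trans ?_
    rw [zero_add, div_mul_eq_mul_div, div_le_iff₀ (by positivity)]
    nlinarith
  -- invariance of the density under permutations
  have hΦσ : ∀ (σ : Equiv.Perm ι) (x : ι → E), Φ (fun i => x (σ i)) = Φ x := by
    intro σ x
    have e : D (fun i => x (σ i)) = (Equiv.Perm.sign σ : ℂ) * D x :=
      Matrix.det_permute' σ (Matrix.of fun i j => f i (x j))
    have e1 : ((Equiv.Perm.sign σ : ℤ) : ℂ) * (starRingEnd ℂ) ((Equiv.Perm.sign σ : ℤ) : ℂ) = 1 := by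
      rcases Int.units_eq_one_or (Equiv.Perm.sign σ) with h | h <;> simp [h]
    simp only [hΦ, e, map_mul]
    rw [Equiv.prod_comp σ fun i => ρ (x i)]
    linear_combination (D x * (starRingEnd ℂ) (D x) * ∏ i, ρ (x i)) * e1
  have hperm : ∀ (σ : Equiv.Perm ι) (φ : (ι → E) → ℂ),
      ∫ x, φ (fun i => x (σ i)) * Φ x ∂P = ∫ x, φ x * Φ x ∂P := by
    intro σ φ
    have hmp := measurePreserving_piCongrLeft (fun _ : ι => ν) σ.symm
    have := hmp.integral_comp' (fun x => φ x * Φ x)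
    rw [← this]
    refine integral_congr_ae (Filter.Eventually.of_forall fun x => ?_)
    have e : (MeasurableEquiv.piCongrLeft (fun _ : ι => E) σ.symm) x = fun i => x (σ i) := by
      funext i
      have := Equiv.piCongrLeft_apply_apply (fun _ : ι => E) σ.symm x (σ i)
      rw [Equiv.symm_apply_apply] at this
      exact this
    simp only [e, hΦσ]
  refine ae_eq_zero_of_integral_contDiff_smul_eq_zero hΦint.locallyIntegrable fun g hg _ => ?_
  have hgc : Continuous fun x => (g x : ℂ) := Complex.continuous_ofReal.comp hg.continuous
  have hgσ : ∀ σ : Equiv.Perm ι, Continuous fun x : ι → E => (g fun i => x (σ i) : ℂ) :=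
    fun σ => hgc.comp (continuous_pi fun i => continuous_apply (σ i))
  -- Symmetrizing an arbitrary test function costs nothing: `Φ` is invariant, so all the permuted
  -- terms have the same integral.
  have h1 := hsymm (fun x => ∑ σ : Equiv.Perm ι, (g fun i => x (σ i) : ℂ))
    (continuous_finsetSum _ fun σ _ => hgσ σ)
    (fun τ x => Fintype.sum_equiv (Equiv.mulLeft τ) _ _ fun σ => rfl)
  simp only [Finset.sum_mul] at h1
  rw [integral_finsetSum _ fun σ _ => hmulint (hgσ σ)] at h1
  simp only [hperm _ (fun x => (g x : ℂ)), Finset.sum_const, nsmul_eq_mul] at h1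
  have h2 : ((Finset.univ : Finset (Equiv.Perm ι)).card : ℂ) ≠ 0 := by
    rw [Finset.card_univ]
    exact_mod_cast Fintype.card_ne_zero
  simpa [Complex.real_smul] using (mul_eq_zero.1 h1).resolve_left h2

/-- Under the hypotheses of `ae_det_mul_eq_zero`, the support of `ν` has fewer than `card ι`
points. -/
theorem not_injective_of_mem_support {ν : Measure E} [IsFiniteMeasure ν] {K : Set E}
    (hK : IsCompact K)
    (hνK : ∀ᵐ x ∂ν, x ∈ K) {ρ : E → ℂ} (hρ : Integrable ρ ν) (hρ0 : ∀ᵐ x ∂ν, ρ x ≠ 0)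
    (hsep : ∀ x y : E, x ≠ y → ∃ f ∈ A, f x ≠ f y) (hc : ∀ f ∈ A, Continuous f)
    (hdet : ∀ f g : ι → E → ℂ, (∀ i, f i ∈ A) → (∀ i, g i ∈ A) →
      (Matrix.of fun i j => ∫ w, f i w * (starRingEnd ℂ) (g j w) * ρ w ∂ν).det = 0)
    {a : ι → E} (ha : ∀ i, a i ∈ ν.support) : ¬ Function.Injective a := by
  classical
  intro hinj
  -- Functions dual to the points `a j`: the alternant at `a` is the determinant of the identity,
  -- hence nonzero on a box around `a`, and this box has positive product measure.
  have h := fun i => exists_mem_eq_one_and_eq_zero hsep (Finset.univ.image a) (a i)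
  choose f hf h1 h0 using h
  have hae := ae_det_mul_eq_zero hK hνK hρ hsep hc hdet hf
  have hDc : Continuous fun x : ι → E => (Matrix.of fun i j => f i (x j)).det := by
    refine Continuous.matrix_det (continuous_matrix fun i j => ?_)
    exact (hc _ (hf i)).comp (continuous_apply j)
  have hDa : (Matrix.of fun i j => f i (a j)).det ≠ 0 := by
    have : (Matrix.of fun i j => f i (a j)) = (1 : Matrix ι ι ℂ) := by
      ext i j
      rw [Matrix.one_apply]
      split_ifs with hij
      · subst hij; exact h1 i
      · exact h0 i (a j) (by simp) fun e => hij (hinj e).symm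
    rw [this, Matrix.det_one]
    exact one_ne_zero
  have hopen : IsOpen {x : ι → E | (Matrix.of fun i j => f i (x j)).det ≠ 0} :=
    isOpen_ne_fun hDc continuous_const
  obtain ⟨u, hu, hsub⟩ := isOpen_pi_iff'.1 hopen a hDa
  have hpos : 0 < (Measure.pi fun _ : ι => ν) (univ.pi u) := by
    rw [Measure.pi_pi]
    exact pos_iff_ne_zero.2 (Finset.prod_ne_zero_iff.2 fun i _ =>
      ((Measure.mem_support_iff_forall (a i)).1 (ha i) _ ((hu i).1.mem_nhds (hu i).2)).ne')
  have hρ' : ∀ᵐ x ∂(Measure.pi fun _ : ι => ν), x ∈ univ.pi fun _ : ι => {w | ρ w ≠ 0} :=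
    ae_pi_mem hρ0
  have hnull : ∀ᵐ x ∂(Measure.pi fun _ : ι => ν), x ∉ univ.pi u := by
    filter_upwards [hae, hρ'] with x hx hxρ hxu
    have hD := hsub hxu
    have hR : ∏ i, ρ (x i) ≠ 0 := Finset.prod_ne_zero_iff.2 fun i _ => hxρ i trivial
    exact mul_ne_zero (mul_ne_zero hD ((map_ne_zero _).2 hD)) hR hx
  rw [ae_iff] at hnull
  simp only [not_not, ofPred_mem_eq] at hnull
  exact hpos.ne' hnull

end Vanishing

end Toeplitz

namespace Toeplitz

/-! ### Polar decomposition of a complex measure. -/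

section ComplexMeasure

variable {X : Type*} [MeasurableSpace X]

theorem sum_apply_set {ι : Type*} (s : Finset ι) (v : ι → ComplexMeasure X) (B : Set X) :
    (∑ i ∈ s, v i) B = ∑ i ∈ s, v i B := by
  rw [FunLike.coe_sum, Finset.sum_apply]

/-- A set of zero variation is null for `μ`, so Radon–Nikodym applies to the real and imaginary
parts separately. -/
theorem withDensityᵥ_rnDeriv_variation (μ : ComplexMeasure X) :
    μ.variation.withDensityᵥ (μ.rnDeriv μ.variation) = μ := by
  have := isFiniteMeasure_variation μ
  have hac : VectorMeasure.AbsolutelyContinuous μ μ.variation.toENNRealVectorMeasure := by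
    refine VectorMeasure.AbsolutelyContinuous.mk fun s hs h => ?_
    rw [Measure.toENNRealVectorMeasure_apply_measurable hs] at h
    exact (VectorMeasure.variation_apply_eq_zero hs).1 h s le_rfl hs
  rw [ComplexMeasure.absolutelyContinuous_ennreal_iff] at hac
  have hρ := ComplexMeasure.integrable_rnDeriv μ μ.variation
  ext i hi : 1
  rw [withDensityᵥ_apply hρ hi]
  apply Complex.ext
  · have h := congrArg (fun v => v i) (SignedMeasure.withDensityᵥ_rnDeriv_eq _ _ hac.1)
    simp only [withDensityᵥ_apply (SignedMeasure.integrable_rnDeriv _ _) hi] at h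
    rw [← RCLike.re_eq_complex_re, ← integral_re hρ.integrableOn]
    exact h
  · have h := congrArg (fun v => v i) (SignedMeasure.withDensityᵥ_rnDeriv_eq _ _ hac.2)
    simp only [withDensityᵥ_apply (SignedMeasure.integrable_rnDeriv _ _) hi] at h
    rw [← RCLike.im_eq_complex_im, ← integral_im hρ.integrableOn]
    exact h

/-- The variation of `ρ|μ|` is `|ρ||μ|`. As `ρ|μ| = μ`, this equals `|μ|`, and uniqueness of
densities gives `|ρ| = 1`. -/
theorem norm_rnDeriv_variation (μ : ComplexMeasure X) :
    ∀ᵐ x ∂μ.variation, ‖μ.rnDeriv μ.variation x‖ = 1 := by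
  have := isFiniteMeasure_variation μ
  have hρ := ComplexMeasure.integrable_rnDeriv μ μ.variation
  have h := Measure.variation_withDensityᵥ hρ
  rw [withDensityᵥ_rnDeriv_variation] at h
  have h2 : μ.variation.withDensity (fun x => ‖μ.rnDeriv μ.variation x‖ₑ) =
      μ.variation.withDensity 1 := by rw [← h, withDensity_one]
  rw [withDensity_eq_iff hρ.1.enorm measurable_one.aemeasurable hρ.2.ne] at h2
  filter_upwards [h2] with x hx
  have : ‖μ.rnDeriv μ.variation x‖ₑ = 1 := hx
  rw [← toReal_enorm, this, ENNReal.toReal_one]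

/-- Integration against a complex measure in terms of its polar decomposition. -/
theorem cintegral_eq_integral (μ : ComplexMeasure X) {f : X → ℂ} (hf : Integrable f μ.variation) :
    cintegral μ f = ∫ x, f x * μ.rnDeriv μ.variation x ∂μ.variation := by
  have := isFiniteMeasure_variation μ
  set ν := μ.variation with hν
  set ρ := μ.rnDeriv ν with hρdef
  have hρ : Integrable ρ ν := ComplexMeasure.integrable_rnDeriv μ ν
  have hρ1 : ∀ᵐ x ∂ν, ‖ρ x‖ ≤ 1 := (norm_rnDeriv_variation μ).mono fun x hx => hx.le
  have hmul : ∀ {f : X → ℂ}, Integrable f ν → Integrable (fun x => f x * ρ x) ν :=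
    fun h => h.mul_bdd (c := 1) hρ.1 hρ1
  refine Integrable.induction (fun f => cintegral μ f = ∫ x, f x * ρ x ∂ν) ?_ ?_ ?_ ?_ hf
  · intro c s hs hsν
    have h1 : cintegral μ (s.indicator fun _ => c) = c * μ s := by
      unfold cintegral
      rw [VectorMeasure.integral_eq_setToFun, setToFun_indicator_const _ hs hsν.ne]
      rfl
    have h2 : (fun x => s.indicator (fun _ => c) x * ρ x) = s.indicator fun x => c * ρ x := by
      funext x
      by_cases hx : x ∈ s <;> simp [hx]
    rw [h1, h2, integral_indicator hs, integral_const_mul, ← withDensityᵥ_apply hρ hs,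
      withDensityᵥ_rnDeriv_variation]
  · intro f g _ hf hg h1 h2
    have := cintegral_add μ hf hg
    simp only [Pi.add_apply, add_mul]
    rw [integral_add (hmul hf) (hmul hg), ← h1, ← h2]
    exact this
  -- Both sides are continuous on `L¹`, the right one being 1-Lipschitz because `|ρ| ≤ 1`.
  · refine isClosed_eq VectorMeasure.continuous_integral ?_
    refine LipschitzWith.continuous (K := 1) (LipschitzWith.of_dist_le_mul fun f g => ?_)
    rw [NNReal.coe_one, one_mul, L1.dist_eq_integral_dist, dist_eq_norm,
      ← integral_sub (hmul (L1.integrable_coeFn f)) (hmul (L1.integrable_coeFn g))]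
    refine norm_integral_le_of_norm_le ?_ ?_
    · simp_rw [dist_eq_norm]
      exact ((L1.integrable_coeFn f).sub (L1.integrable_coeFn g)).norm
    · filter_upwards [hρ1] with x hx
      rw [← sub_mul, norm_mul, dist_eq_norm]
      exact mul_le_of_le_one_right (norm_nonneg _) hx
  · intro f g h _ h1
    have e : cintegral μ f = cintegral μ g := VectorMeasure.integral_congr_ae h
    rw [← e, h1]
    refine integral_congr_ae ?_
    filter_upwards [h] with x hx
    rw [hx]

end ComplexMeasure

/-! ### Measures with finite support and the rank of their operators. -/

section FiniteSupport

variable {d : ℕ} {Ω : Set (Fin d → ℂ)} {μ : ComplexMeasure (Fin d → ℂ)}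

/-- A complex measure whose variation has at most `N` points in its support is a combination of
at most `N` point masses. -/
theorem exists_isCombOfPointMasses (hμ : HasCompactSupportIn μ Ω) {N : ℕ}
    (h : μ.variation.support.encard ≤ N) : ∃ M ≤ N, IsCombOfPointMasses M Ω μ := by
  classical
  have hfin : μ.variation.support.Finite := Set.finite_of_encard_le_coe h
  set S : Finset (Fin d → ℂ) := hfin.toFinset with hS
  have hScard : S.card ≤ N := by
    have := hfin.encard_eq_coe_toFinset_card
    rw [this] at h
    exact_mod_cast h
  -- Dropping the points without mass makes all coefficients nonzero; this only lowers the number of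
  -- points, hence `M ≤ N` in the conclusion.
  set T : Finset (Fin d → ℂ) := S.filter fun a => μ {a} ≠ 0 with hT
  refine ⟨T.card, (Finset.card_filter_le _ _).trans hScard, fun i => (T.equivFin.symm i : Fin d → ℂ),
    fun i => μ {(T.equivFin.symm i : Fin d → ℂ)}, ?_, ?_, ?_, ?_⟩
  · exact Subtype.val_injective.comp T.equivFin.symm.injective
  · intro i
    obtain ⟨K, -, hKΩ, h0⟩ := hμ
    have hne : μ {(T.equivFin.symm i : Fin d → ℂ)} ≠ 0 :=
      (Finset.mem_filter.1 (T.equivFin.symm i).2).2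
    by_contra hni
    exact hne (h0 _ (measurableSet_singleton _) (disjoint_singleton_left.2 fun hk => hni (hKΩ hk)))
  · intro i
    exact (Finset.mem_filter.1 (T.equivFin.symm i).2).2
  · ext A hA : 1
    have hsum : ∀ g : (Fin d → ℂ) → ℂ, ∑ i, g (T.equivFin.symm i : Fin d → ℂ) = ∑ a ∈ T, g a := by
      intro g
      rw [Equiv.sum_comp T.equivFin.symm fun a => g a, Finset.sum_coe_sort]
    have hd : ∀ a, VectorMeasure.dirac a (μ {a}) A = if a ∈ A then μ {a} else 0 := by
      intro a
      split_ifs with ha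
      · exact VectorMeasure.dirac_apply_of_mem hA ha
      · exact VectorMeasure.dirac_apply_of_notMem ha
    have h1 : (∑ i, VectorMeasure.dirac (T.equivFin.symm i : Fin d → ℂ)
        (μ {(T.equivFin.symm i : Fin d → ℂ)})) A = ∑ a ∈ S, if a ∈ A then μ {a} else 0 := by
      rw [sum_apply_set, hsum fun a => VectorMeasure.dirac a (μ {a}) A, hT, Finset.sum_filter]
      refine Finset.sum_congr rfl fun a _ => ?_
      rw [hd]
      split_ifs with h1 h2 <;> simp_all
    rw [h1, ← Finset.sum_filter]
    have hS0 : μ.variation (A \ S) = 0 := by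
      refine measure_mono_null (fun x hx => ?_) (Measure.measure_compl_support (μ := μ.variation))
      intro hxs
      exact hx.2 (by simpa [hS] using hxs)
    have hAS : MeasurableSet (A \ S) := hA.diff S.measurableSet
    have h2 : μ (A \ S) = 0 := (VectorMeasure.variation_apply_eq_zero hAS).1 hS0 _ le_rfl hAS
    have h3 : A = (⋃ a ∈ S.filter (· ∈ A), {a}) ∪ (A \ S) := by
      ext x
      by_cases hx : x ∈ S <;> by_cases hx' : x ∈ A <;> simp [hx, hx']
    have h4 : MeasurableSet (⋃ a ∈ S.filter (· ∈ A), ({a} : Set (Fin d → ℂ))) :=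
      Finset.measurableSet_biUnion _ fun a _ => measurableSet_singleton a
    have h5 : Disjoint (⋃ a ∈ S.filter (· ∈ A), ({a} : Set (Fin d → ℂ))) (A \ S) := by
      rw [Set.disjoint_left]
      intro x hx hx'
      simp only [Finset.mem_filter, mem_iUnion, mem_singleton_iff, exists_prop] at hx
      obtain ⟨a, ⟨ha, _⟩, rfl⟩ := hx
      exact hx'.2 ha
    conv_lhs => rw [h3]
    rw [VectorMeasure.of_union h5 h4 hAS, h2, add_zero,
      VectorMeasure.of_biUnion_finset (fun a _ b _ hab => by simpa using hab)
        fun a _ => measurableSet_singleton a]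

theorem cintegral_sum_dirac {M : ℕ} (z : Fin M → Fin d → ℂ) (c : Fin M → ℂ)
    (f : (Fin d → ℂ) → ℂ) :
    cintegral (∑ i, VectorMeasure.dirac (z i) (c i)) f = ∑ i, f (z i) * c i := by
  unfold cintegral
  rw [VectorMeasure.integral_finsetSum_vectorMeasure]
  · refine Finset.sum_congr rfl fun i _ => ?_
    rw [VectorMeasure.integral_dirac]
    rfl
  · intro i _
    rw [VectorMeasure.Integrable, VectorMeasure.variation_dirac]
    exact (integrable_dirac (by finiteness)).smul_measure (by finiteness)

/-- The Toeplitz operator of a combination of `M` point masses has rank at most `M`. -/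
theorem rank_toeplitz_le {ν : Measure (Fin d → ℂ)} {Q : (Fin d → ℂ) → (Fin d → ℂ) → ℂ}
    (hQ : ∀ z, ContinuousOn (Q z) Ω) (hμ : HasCompactSupportIn μ Ω) {M : ℕ}
    (h : IsCombOfPointMasses M Ω μ) : (toeplitz Ω ν Q hQ μ hμ).rank ≤ M := by
  obtain ⟨z, c, -, -, -, rfl⟩ := h
  -- The image lies in the span of the `M` functions `Q(·, zᵢ)`.
  have hle : LinearMap.range (toeplitz Ω ν Q hQ _ hμ) ≤
      Submodule.span ℂ (Set.range fun i => fun w => Q w (z i)) := by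
    rintro _ ⟨u, rfl⟩
    have : toeplitz Ω ν Q hQ _ hμ u =
        ∑ i, ((u : (Fin d → ℂ) → ℂ) (z i) * c i) • fun w => Q w (z i) := by
      funext w
      refine (cintegral_sum_dirac z c _).trans ?_
      rw [Finset.sum_apply]
      refine Finset.sum_congr rfl fun i _ => ?_
      simp only [Pi.smul_apply, smul_eq_mul]
      ring
    rw [this]
    exact Submodule.sum_mem _ fun i _ => Submodule.smul_mem _ _ (Submodule.subset_span ⟨i, rfl⟩)
  refine (Submodule.rank_mono hle).trans ((rank_span_le _).trans ?_)
  exact Cardinal.mk_range_le.trans (by simp)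

/-- Points are Lebesgue null when `d ≥ 1`, so no nonzero point mass can occur. For `d = 0` the
volume is itself a point mass. -/
theorem IsCombOfPointMasses.eq_zero_of_absolutelyContinuous (hd : 1 ≤ d) {N : ℕ}
    (h : IsCombOfPointMasses N Ω μ) (hac : VectorMeasure.AbsolutelyContinuous μ
      (volume : Measure (Fin d → ℂ)).toENNRealVectorMeasure) : μ = 0 := by
  have : Nonempty (Fin d) := ⟨⟨0, hd⟩⟩
  obtain ⟨z, c, hz, -, hc, rfl⟩ := h
  have hN : IsEmpty (Fin N) := by
    refine ⟨fun i => hc i ?_⟩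
    have h0 := hac (s := {z i}) (by
      rw [Measure.toENNRealVectorMeasure_apply_measurable (measurableSet_singleton _)]
      exact measure_singleton _)
    rw [sum_apply_set, Finset.sum_eq_single i] at h0
    · rwa [VectorMeasure.dirac_apply_of_mem (measurableSet_singleton _) rfl] at h0
    · intro j _ hj
      exact VectorMeasure.dirac_apply_of_notMem fun e => hj (hz e)
    · simp
  exact Finset.sum_of_isEmpty _

end FiniteSupport

/-! ### From finite rank to point masses, for a general kernel. -/

section Reduction

variable {d : ℕ} {Ω : Set (Fin d → ℂ)} {μ : ComplexMeasure (Fin d → ℂ)}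

theorem exists_isCompact_ae_mem (hμ : HasCompactSupportIn μ Ω) :
    ∃ K : Set (Fin d → ℂ), IsCompact K ∧ K ⊆ Ω ∧ ∀ᵐ x ∂μ.variation, x ∈ K := by
  obtain ⟨K, hK, hKΩ, h0⟩ := hμ
  refine ⟨K, hK, hKΩ, ?_⟩
  rw [ae_iff]
  change μ.variation Kᶜ = 0
  rw [VectorMeasure.variation_apply_eq_zero hK.measurableSet.compl]
  intro t ht htm
  exact h0 t htm (disjoint_compl_left_iff_subset.2 le_rfl |>.mono_left ht)

/-- Finite rank Toeplitz operators come from point masses, provided that the domain contains a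
suitable algebra of functions, and that the kernel of the operator is orthogonal to that algebra. -/
theorem isCombOfPointMasses_of_rank_eq {ν : Measure (Fin d → ℂ)}
    {Q : (Fin d → ℂ) → (Fin d → ℂ) → ℂ}
    (hQ : ∀ z, ContinuousOn (Q z) Ω) (hμ : HasCompactSupportIn μ Ω)
    {A : Subalgebra ℂ ((Fin d → ℂ) → ℂ)}
    (hsep : ∀ x y, x ≠ y → ∃ f ∈ A, f x ≠ f y) (hc : ∀ f ∈ A, Continuous f)
    (hA : ∀ f ∈ A, Ω.indicator f ∈ holL2 Ω ν)
    (hker : ∀ u ∈ holL2 Ω ν, (∀ z, cintegral μ (fun w => u w * Q z w) = 0) →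
      ∀ g ∈ A, cintegral μ (fun w => u w * (starRingEnd ℂ) (g w)) = 0) {N : ℕ}
    (hN : (toeplitz Ω ν Q hQ μ hμ).rank = N) : IsCombOfPointMasses N Ω μ := by
  classical
  have := isFiniteMeasure_variation μ
  obtain ⟨K, hK, hKΩ, hνK⟩ := exists_isCompact_ae_mem hμ
  have hρ := ComplexMeasure.integrable_rnDeriv μ μ.variation
  set ρ := μ.rnDeriv μ.variation with hρdef
  have hρ0 : ∀ᵐ x ∂μ.variation, ρ x ≠ 0 := (norm_rnDeriv_variation μ).mono fun x hx h0 => by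
    rw [← hρdef, h0, norm_zero] at hx
    exact zero_ne_one hx
  have hdet : ∀ f g : Fin (N + 1) → (Fin d → ℂ) → ℂ, (∀ i, f i ∈ A) → (∀ i, g i ∈ A) →
      (Matrix.of fun i j => ∫ w, f i w * (starRingEnd ℂ) (g j w) * ρ w ∂μ.variation).det = 0 := by
    intro f g hf hg
    let u : Fin (N + 1) → holL2 Ω ν := fun i => ⟨Ω.indicator (f i), hA _ (hf i)⟩
    let T := toeplitz Ω ν Q hQ μ hμ
    -- `N + 1` vectors in a range of dimension `N`. The coefficients of the dependence form a row
    -- vector annihilating the matrix.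
    have hdep : ¬ LinearIndependent ℂ fun i => T.rangeRestrict (u i) := by
      intro hli
      have h1 := hli.cardinal_lift_le_rank
      have h2 : Module.rank ℂ (LinearMap.range T) = N := hN
      rw [h2] at h1
      simp only [Cardinal.mk_fin, Cardinal.lift_natCast, Nat.cast_le] at h1
      omega
    rw [Fintype.not_linearIndependent_iff] at hdep
    obtain ⟨c, hc0, i₀, hi₀⟩ := hdep
    have hT0 : T (∑ i, c i • u i) = 0 := by
      have := congrArg Subtype.val hc0
      rw [map_sum]
      simpa using this
    have hz := hker _ (∑ i, c i • u i).2 fun z => congrFun hT0 z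
    rw [← Matrix.exists_vecMul_eq_zero_iff]
    refine ⟨c, fun h => hi₀ (congrFun h i₀), ?_⟩
    funext j
    have hcont : ∀ i, Continuous fun w => f i w * (starRingEnd ℂ) (g j w) := fun i =>
      (hc _ (hf i)).mul (Complex.continuous_conj.comp (hc _ (hg j)))
    have hint : ∀ i, Integrable (fun w => f i w * (starRingEnd ℂ) (g j w) * ρ w) μ.variation :=
      fun i => integrable_mul_of_continuous hK hνK hρ (hcont i)
    have hzj := hz (g j) (hg j)
    have hae : (fun w => ((∑ i, c i • u i : holL2 Ω ν) : (Fin d → ℂ) → ℂ) w *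
        (starRingEnd ℂ) (g j w)) =ᵐ[μ.variation]
        fun w => ∑ i, c i * (f i w * (starRingEnd ℂ) (g j w)) := by
      filter_upwards [hνK] with w hw
      have : ((∑ i, c i • u i : holL2 Ω ν) : (Fin d → ℂ) → ℂ) w = ∑ i, c i * f i w := by
        simp [u, Finset.sum_apply, indicator_of_mem (hKΩ hw)]
      rw [this, Finset.sum_mul]
      exact Finset.sum_congr rfl fun i _ => by ring
    have hcs : Continuous fun w => ∑ i, c i * (f i w * (starRingEnd ℂ) (g j w)) :=
      continuous_finsetSum _ fun i _ => continuous_const.mul (hcont i)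
    have e : cintegral μ (fun w => ((∑ i, c i • u i : holL2 Ω ν) : (Fin d → ℂ) → ℂ) w *
        (starRingEnd ℂ) (g j w)) = cintegral μ _ := VectorMeasure.integral_congr_ae hae
    rw [e, cintegral_eq_integral μ (integrable_of_continuousOn hμ hcs.continuousOn)] at hzj
    simp only [Finset.sum_mul, mul_assoc (c _)] at hzj
    rw [integral_finsetSum _ fun i _ => (hint i).const_mul _] at hzj
    simp only [integral_const_mul] at hzj
    simpa [Matrix.vecMul, dotProduct] using hzj
  have hsupp : μ.variation.support.encard ≤ N := by
    by_contra hlt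
    have hlt' : ((N + 1 : ℕ) : ℕ∞) ≤ μ.variation.support.encard := by
      push_cast
      exact Order.add_one_le_of_lt (not_le.1 hlt)
    obtain ⟨t, ht, htc⟩ := Set.exists_subset_encard_eq hlt'
    have htf : t.Finite := Set.finite_of_encard_eq_coe htc
    have hcard : htf.toFinset.card = N + 1 := by
      rw [htf.encard_eq_coe_toFinset_card] at htc
      exact_mod_cast htc
    let a : Fin (N + 1) → Fin d → ℂ := fun i => (htf.toFinset.equivFinOfCardEq hcard).symm i
    refine not_injective_of_mem_support hK hνK hρ hρ0 hsep hc hdet (a := a) (fun i => ht ?_)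
      (Subtype.val_injective.comp (Equiv.injective _))
    exact htf.mem_toFinset.1 ((htf.toFinset.equivFinOfCardEq hcard).symm i).2
  obtain ⟨M, hM, hcomb⟩ := exists_isCombOfPointMasses hμ hsupp
  -- This is the inequality `N ≤ M`, which makes the number of points exactly `N`.
  have hle := rank_toeplitz_le (ν := ν) hQ hμ hcomb
  rw [hN] at hle
  have : N = M := le_antisymm (by exact_mod_cast hle) hM
  exact this ▸ hcomb

end Reduction

end Toeplitz

noncomputable section

namespace Toeplitz

/-! ### The algebra of exponential polynomials -/

/-- The exponential `w ↦ exp (∑ aⱼ wⱼ)`. -/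
def expLinear {d : ℕ} (a : Fin d → ℂ) (w : Fin d → ℂ) : ℂ := Complex.exp (∑ j, a j * w j)

/-- The algebra of functions spanned by the exponentials of linear forms. -/
def expAlgebra (d : ℕ) : Subalgebra ℂ ((Fin d → ℂ) → ℂ) := Algebra.adjoin ℂ (range expLinear)

variable {d : ℕ}

theorem expLinear_zero : expLinear (0 : Fin d → ℂ) = 1 := by
  funext w
  simp [expLinear]

theorem expLinear_add (a b : Fin d → ℂ) : expLinear (a + b) = expLinear a * expLinear b := by
  funext w
  simp [expLinear, add_mul, Finset.sum_add_distrib, Complex.exp_add]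

/-- Exponentials are closed under products, so the algebra is their linear span, and claims linear
or conjugate-linear in the function need checking on exponentials only. -/
theorem toSubmodule_expAlgebra :
    Subalgebra.toSubmodule (expAlgebra d) = Submodule.span ℂ (range expLinear) := by
  refine Algebra.adjoin_eq_span_of_subset (R := ℂ) (s := range (expLinear (d := d))) ?_
  intro f hf
  refine Submodule.subset_span ?_
  induction hf using Submonoid.closure_induction with
  | mem f hf => exact hf
  | one => exact ⟨0, expLinear_zero⟩
  | mul f g _ _ hf hg =>
    obtain ⟨a, rfl⟩ := hf
    obtain ⟨b, rfl⟩ := hg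
    exact ⟨a + b, expLinear_add a b⟩

theorem mem_expAlgebra_iff {f : (Fin d → ℂ) → ℂ} :
    f ∈ expAlgebra d ↔ f ∈ Submodule.span ℂ (range (expLinear (d := d))) := by
  rw [← toSubmodule_expAlgebra]
  rfl

theorem differentiable_expLinear (a : Fin d → ℂ) : Differentiable ℂ (expLinear a) := by
  unfold expLinear
  fun_prop

theorem differentiable_of_mem_expAlgebra {f : (Fin d → ℂ) → ℂ} (hf : f ∈ expAlgebra d) :
    Differentiable ℂ f := by
  rw [mem_expAlgebra_iff] at hf
  induction hf using Submodule.span_induction with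
  | mem f hf =>
    obtain ⟨a, rfl⟩ := hf
    exact differentiable_expLinear a
  | zero => exact differentiable_const 0
  | add f g _ _ hf hg => exact hf.add hg
  | smul c f _ hf => exact hf.const_smul c

theorem exists_expAlgebra_ne {x y : Fin d → ℂ} (hxy : x ≠ y) : ∃ f ∈ expAlgebra d, f x ≠ f y := by
  obtain ⟨j, hj⟩ := Function.ne_iff.1 hxy
  have hsub : x j - y j ≠ 0 := sub_ne_zero.2 hj
  -- With this coefficient the exponents at `x` and `y` differ by exactly 1, so periodicity of `exp`
  -- cannot interfere.
  refine ⟨expLinear (Pi.single j (x j - y j)⁻¹), Algebra.subset_adjoin ⟨_, rfl⟩, fun h => ?_⟩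
  have hval : ∀ w : Fin d → ℂ, expLinear (Pi.single j (x j - y j)⁻¹) w =
      Complex.exp ((x j - y j)⁻¹ * w j) := by
    intro w
    unfold expLinear
    congr 1
    rw [Finset.sum_eq_single j] <;> simp +contextual
  rw [hval, hval] at h
  have h1 : Complex.exp 1 = 1 := by
    have : (1 : ℂ) = (x j - y j)⁻¹ * x j - (x j - y j)⁻¹ * y j := by
      rw [← mul_sub, inv_mul_cancel₀ hsub]
    conv_lhs => rw [this]
    rw [Complex.exp_sub, h, div_self (Complex.exp_ne_zero _)]
  have h2 := congrArg norm h1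
  rw [Complex.norm_exp, norm_one, Complex.one_re] at h2
  exact absurd (Real.exp_eq_one_iff 1 |>.1 h2) one_ne_zero

/-! ### The Bargmann space -/

theorem integrable_norm_exp_sq_mul_gaussian (a : ℂ) :
    Integrable fun v : ℂ => ‖Complex.exp (a * v)‖ ^ 2 * Real.exp (-‖v‖ ^ 2 / 2) := by
  -- The real inner product of `conj a` and `v` is `Re (a v)`, and `|exp (a v)|² = exp (2 Re (a
  -- v))`.
  have h := (GaussianFourier.integrable_cexp_neg_mul_sq_norm_add (b := (1 / 2 : ℂ)) (by norm_num) 2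
    ((starRingEnd ℂ) a)).norm
  refine h.congr (Filter.Eventually.of_forall fun v => ?_)
  simp only [Complex.norm_exp]
  rw [← Real.exp_nat_mul, ← Real.exp_add]
  congr 1
  simp only [Complex.add_re, Complex.neg_re, Complex.mul_re, Complex.inner,
    Complex.conj_conj, Complex.ofReal_re, Complex.ofReal_im]
  have hv : ((‖v‖ : ℂ) ^ 2).re = ‖v‖ ^ 2 := by rw [← Complex.ofReal_pow, Complex.ofReal_re]
  simp [hv]
  ring

theorem memLp_expLinear_gaussian (a : Fin d → ℂ) : MemLp (expLinear a) 2 (gaussian d) := by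
  have hc : Continuous (expLinear a) := (differentiable_expLinear a).continuous
  rw [memLp_two_iff_integrable_sq_norm hc.aestronglyMeasurable]
  unfold gaussian
  rw [integrable_withDensity_iff (by fun_prop) (Filter.Eventually.of_forall fun _ => by simp)]
  have h := (Integrable.fintype_prod (μ := fun _ : Fin d => (volume : Measure ℂ))
    (f := fun j v => ‖Complex.exp (a j * v)‖ ^ 2 * Real.exp (-‖v‖ ^ 2 / 2))
    fun j => integrable_norm_exp_sq_mul_gaussian (a j)).const_mul (((2 * Real.pi) ^ d)⁻¹)
  refine h.congr (Filter.Eventually.of_forall fun w => ?_)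
  dsimp only
  rw [ENNReal.toReal_ofReal (by positivity), Finset.prod_mul_distrib, Finset.prod_pow,
    ← norm_prod, ← Complex.exp_sum, ← Real.exp_sum, ← Finset.sum_div, Finset.sum_neg_distrib]
  unfold expLinear
  ring

theorem mem_bargmannSpace_of_mem_expAlgebra {f : (Fin d → ℂ) → ℂ} (hf : f ∈ expAlgebra d) :
    f ∈ bargmannSpace d := by
  rw [mem_expAlgebra_iff] at hf
  refine (Submodule.span_le (p := bargmannSpace d)).2 ?_ hf
  rintro _ ⟨a, rfl⟩
  refine ⟨(differentiable_expLinear a).differentiableOn, ?_, fun z hz => absurd (mem_univ z) hz⟩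
  rw [Measure.restrict_univ]
  exact memLp_expLinear_gaussian a

/-- Because of this, `T u = 0` evaluated at a suitable point is already the orthogonality of `u` to
an exponential. -/
theorem conj_expLinear_eq_bargmannKernel (a w : Fin d → ℂ) :
    (starRingEnd ℂ) (expLinear a w) = bargmannKernel (fun j => 2 * (starRingEnd ℂ) (a j)) w := by
  unfold expLinear bargmannKernel
  rw [← Complex.exp_conj, map_sum, Finset.sum_div]
  congr 1
  refine Finset.sum_congr rfl fun j _ => ?_
  rw [map_mul]
  ring

theorem isCombOfPointMasses_of_rank_toeplitzBargmann {μ : ComplexMeasure (Fin d → ℂ)}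
    (hμ : HasCompactSupportIn μ univ) {N : ℕ} (hN : (toeplitzBargmann μ hμ).rank = N) :
    IsCombOfPointMasses N univ μ := by
  refine isCombOfPointMasses_of_rank_eq (A := expAlgebra d) _ hμ
    (fun x y => exists_expAlgebra_ne)
    (fun f hf => (differentiable_of_mem_expAlgebra hf).continuous) (fun f hf => ?_)
    (fun u hu h0 g hg => ?_) hN
  · rw [indicator_univ]
    exact mem_bargmannSpace_of_mem_expAlgebra hf
  · have hint : ∀ g ∈ expAlgebra d,
        Integrable (fun w => u w * (starRingEnd ℂ) (g w)) μ.variation := fun g hg =>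
      integrable_of_continuousOn hμ (hu.1.continuousOn.mul (Complex.continuous_conj.comp
        (differentiable_of_mem_expAlgebra hg).continuous).continuousOn)
    rw [mem_expAlgebra_iff] at hg
    induction hg using Submodule.span_induction with
    | mem g hg =>
      obtain ⟨a, rfl⟩ := hg
      simp only [conj_expLinear_eq_bargmannKernel]
      exact h0 _
    | zero =>
      simpa using cintegral_const_mul μ 0 fun _ => (0 : ℂ)
    | add f g hf hg hf0 hg0 =>
      rw [← mem_expAlgebra_iff] at hf hg
      simp only [Pi.add_apply, map_add, mul_add]
      rw [cintegral_add μ (hint f hf) (hint g hg), hf0, hg0, add_zero]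
    | smul c f _ hf0 =>
      simp only [Pi.smul_apply, smul_eq_mul, map_mul, mul_left_comm _ ((starRingEnd ℂ) c)]
      rw [cintegral_const_mul, hf0, mul_zero]

end Toeplitz

end

noncomputable section

namespace Toeplitz

/-! ### Mean value property and derivative estimates -/

section Line

variable {E : Type*} [NormedAddCommGroup E] [NormedSpace ℂ E] {Ω : Set E} {u : E → ℂ}

theorem add_smul_mem_closedBall {z w : E} {r : ℝ} (hw : ‖w‖ ≤ r) {ζ : ℂ} (hζ : ‖ζ‖ ≤ 1) :
    z + ζ • w ∈ Metric.closedBall z r := by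
  rw [mem_closedBall_iff_norm, add_sub_cancel_left, norm_smul]
  exact (mul_le_of_le_one_left (norm_nonneg _) hζ).trans hw

/-- Restriction to complex lines through `z` brings the mean value property and Cauchy's estimate
down to one variable. -/
theorem diffContOnCl_line (hu : DifferentiableOn ℂ u Ω) {z : E} {r : ℝ}
    (hz : Metric.closedBall z r ⊆ Ω) {w : E} (hw : ‖w‖ ≤ r) :
    DiffContOnCl ℂ (fun ζ : ℂ => u (z + ζ • w)) (Metric.ball 0 1) := by
  have hmaps : MapsTo (fun ζ : ℂ => z + ζ • w) (Metric.closedBall 0 1) Ω := fun ζ hζ =>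
    hz (add_smul_mem_closedBall hw (mem_closedBall_zero_iff.1 hζ))
  have hd : DifferentiableOn ℂ (fun ζ : ℂ => z + ζ • w) (Metric.closedBall 0 1) := by fun_prop
  exact (hu.comp hd hmaps).diffContOnCl_ball le_rfl

theorem integral_circle_line (hu : DifferentiableOn ℂ u Ω) {z : E} {r : ℝ}
    (hz : Metric.closedBall z r ⊆ Ω) {w : E} (hw : ‖w‖ ≤ r) :
    ∫ θ in Icc 0 (2 * Real.pi), u (z + circleMap 0 1 θ • w) = 2 * Real.pi * u z := by
  have h := diffContOnCl_line hu hz hw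
  rw [← abs_one (α := ℝ)] at h
  have h1 := h.circleAverage
  rw [Real.circleAverage, intervalIntegral.integral_of_le Real.two_pi_pos.le,
    ← integral_Icc_eq_integral_Ioc] at h1
  simp only [zero_smul, add_zero] at h1
  rw [← h1, Complex.real_smul]
  push_cast
  rw [mul_inv_cancel_left₀]
  exact_mod_cast Real.two_pi_pos.ne'

/-- Cauchy's estimate for the derivative of a holomorphic function on a complex normed space. -/
theorem norm_fderiv_le (hΩ : IsOpen Ω) (hu : DifferentiableOn ℂ u Ω) {z : E} {r : ℝ} (hr : 0 < r)
    (hz : Metric.closedBall z r ⊆ Ω) {C : ℝ} (hC : ∀ w ∈ Metric.closedBall z r, ‖u w‖ ≤ C) :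
    ‖fderiv ℂ u z‖ ≤ C / r := by
  have hzΩ : z ∈ Ω := hz (Metric.mem_closedBall_self hr.le)
  have hC0 : 0 ≤ C := (norm_nonneg _).trans (hC z (Metric.mem_closedBall_self hr.le))
  have hd : HasFDerivAt u (fderiv ℂ u z) z := (hu.differentiableAt (hΩ.mem_nhds hzΩ)).hasFDerivAt
  have key : ∀ w : E, ‖w‖ ≤ r → ‖fderiv ℂ u z w‖ ≤ C := by
    intro w hw
    have hl : HasDerivAt (fun ζ : ℂ => z + ζ • w) w 0 := by
      simpa using ((hasDerivAt_id (0 : ℂ)).smul_const w).const_add z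
    have hd' : HasFDerivAt u (fderiv ℂ u z) (z + (0 : ℂ) • w) := by simpa using hd
    have hcomp := hd'.comp_hasDerivAt (0 : ℂ) hl
    have hb := Complex.norm_deriv_le_of_forall_mem_sphere_norm_le (C := C) one_pos
      (diffContOnCl_line hu hz hw)
      fun ζ hζ => hC _ (add_smul_mem_closedBall hw (mem_sphere_zero_iff_norm.1 hζ).le)
    rw [div_one] at hb
    have e : deriv (fun ζ : ℂ => u (z + ζ • w)) 0 = fderiv ℂ u z w := hcomp.deriv
    rwa [e] at hb
  refine ContinuousLinearMap.opNorm_le_bound _ (by positivity) fun v => ?_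
  rcases eq_or_ne v 0 with rfl | hv
  · simp
  have hv' : 0 < ‖v‖ := norm_pos_iff.2 hv
  have h1 := key (((r / ‖v‖ : ℝ) : ℂ) • v) (by
    rw [norm_smul, Complex.norm_real, Real.norm_of_nonneg (by positivity),
      div_mul_cancel₀ _ hv'.ne'])
  rw [map_smul, norm_smul, Complex.norm_real, Real.norm_of_nonneg (by positivity)] at h1
  rw [div_mul_eq_mul_div, le_div_iff₀ hr]
  rw [div_mul_eq_mul_div, div_le_iff₀ hv'] at h1
  linarith

/-- Limits of uniformly Cauchy sequences of holomorphic functions are holomorphic. -/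
theorem differentiableOn_of_forall_exists_uniformCauchySeqOn (hΩ : IsOpen Ω) {u : ℕ → E → ℂ}
    {v : E → ℂ} (hu : ∀ n, DifferentiableOn ℂ (u n) Ω)
    (hcauchy : ∀ z ∈ Ω, ∃ r > 0, Metric.closedBall z r ⊆ Ω ∧
      UniformCauchySeqOn u Filter.atTop (Metric.closedBall z r))
    (hv : ∀ z ∈ Ω, Filter.Tendsto (fun n => u n z) Filter.atTop (nhds (v z))) :
    DifferentiableOn ℂ v Ω := by
  intro z hz
  obtain ⟨r, hr, hrΩ, hCr⟩ := hcauchy z hz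
  have hr2 : 0 < r / 2 := half_pos hr
  have hsub : ∀ x ∈ Metric.ball z (r / 2), Metric.closedBall x (r / 2) ⊆ Metric.closedBall z r := by
    intro x hx
    refine Metric.closedBall_subset_closedBall' ?_
    have := Metric.mem_ball.1 hx
    linarith
  have hmem : ∀ x ∈ Metric.ball z (r / 2), x ∈ Ω := fun x hx =>
    hrΩ (hsub x hx (Metric.mem_closedBall_self hr2.le))
  have hfd : ∀ n, ∀ x ∈ Metric.ball z (r / 2), HasFDerivAt (u n) (fderiv ℂ (u n) x) x :=
    fun n x hx => ((hu n).differentiableAt (hΩ.mem_nhds (hmem x hx))).hasFDerivAt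
  have hunif : UniformCauchySeqOn (fun n => fderiv ℂ (u n)) Filter.atTop
      (Metric.ball z (r / 2)) := by
    rw [Metric.uniformCauchySeqOn_iff] at hCr ⊢
    intro ε hε
    -- Cauchy's estimate on balls of radius `r / 2` divides by `r / 2`, leaving `ε / 2 < ε`.
    obtain ⟨N, hN⟩ := hCr (ε / 2 * (r / 2)) (by positivity)
    refine ⟨N, fun m hm n hn x hx => ?_⟩
    have h1 := norm_fderiv_le (u := u m - u n) hΩ ((hu m).sub (hu n)) hr2
      ((hsub x hx).trans hrΩ) (C := ε / 2 * (r / 2)) (fun w hw => by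
        have := hN m hm n hn w (hsub x hx hw)
        rw [dist_eq_norm] at this
        exact this.le)
    rw [mul_div_cancel_right₀ _ hr2.ne', fderiv_sub (hfd m x hx).differentiableAt
      (hfd n x hx).differentiableAt] at h1
    rw [dist_eq_norm]
    linarith
  have hlim : ∀ x : E, ∃ L : E →L[ℂ] ℂ, x ∈ Metric.ball z (r / 2) →
      Filter.Tendsto (fun n => fderiv ℂ (u n) x) Filter.atTop (nhds L) := by
    intro x
    by_cases hx : x ∈ Metric.ball z (r / 2)
    · have := (hunif.cauchySeq hx)
      obtain ⟨L, hL⟩ := cauchySeq_tendsto_of_complete this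
      exact ⟨L, fun _ => hL⟩
    · exact ⟨0, fun h => absurd h hx⟩
  choose L hL using hlim
  have := hasFDerivAt_of_tendstoUniformlyOn Metric.isOpen_ball
    (hunif.tendstoUniformlyOn_of_tendsto hL) hfd (fun x hx => hv x (hmem x hx))
    (Metric.mem_ball_self hr2)
  exact this.differentiableAt.differentiableWithinAt

end Line

section Polydisc

variable {d : ℕ} {Ω : Set (Fin d → ℂ)} {u : (Fin d → ℂ) → ℂ}

theorem measurePreserving_smul_of_norm_eq_one {c : ℂ} (hc : ‖c‖ = 1) :
    MeasurePreserving (fun w : Fin d → ℂ => c • w) := by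
  exact volume_preserving_pi (f := fun (_ : Fin d) (w : ℂ) => c • w) fun _ =>
    (rotation ⟨c, mem_sphere_zero_iff_norm.2 hc⟩).measurePreserving

/-- The mean value property over polydiscs. -/
theorem setIntegral_closedBall_eq (hu : DifferentiableOn ℂ u Ω) {z : Fin d → ℂ} {r : ℝ}
    (hz : Metric.closedBall z r ⊆ Ω) :
    ∫ w in Metric.closedBall z r, u w = volume.real (Metric.closedBall z r) * u z := by
  set B : Set (Fin d → ℂ) := Metric.closedBall 0 r with hB
  have hBc : IsCompact B := isCompact_closedBall _ _
  have htrans : ∫ w in Metric.closedBall z r, u w = ∫ w in B, u (z + w) := by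
    have hmp := measurePreserving_add_left (volume : Measure (Fin d → ℂ)) z
    rw [← hmp.setIntegral_preimage_emb (measurableEmbedding_addLeft z) u]
    congr 2
    ext w
    simp [hB]
  -- Rotating all coordinates by a common angle preserves volume and the polydisc. Averaging over
  -- the angle and exchanging the integrals replaces `u (z + w)` by its mean on a circle, which is
  -- `u z`.
  have hrot : ∀ θ : ℝ, ∫ w in B, u (z + circleMap 0 1 θ • w) = ∫ w in B, u (z + w) := by
    intro θ
    have hn : ‖circleMap 0 1 θ‖ = 1 := by simp
    have hne : circleMap 0 1 θ ≠ 0 := norm_ne_zero_iff.1 (by rw [hn]; exact one_ne_zero)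
    rw [← (measurePreserving_smul_of_norm_eq_one hn).setIntegral_preimage_emb
      (measurableEmbedding_const_smul₀ hne) (fun w => u (z + w))]
    congr 2
    ext w
    simp only [hB, mem_preimage, mem_closedBall_zero_iff, norm_smul, hn, one_mul]
  have hint : Integrable (Function.uncurry fun (θ : ℝ) (w : Fin d → ℂ) =>
      u (z + circleMap 0 1 θ • w))
      ((volume.restrict (Icc 0 (2 * Real.pi))).prod (volume.restrict B)) := by
    rw [Measure.prod_restrict]
    refine ContinuousOn.integrableOn_compact (isCompact_Icc.prod hBc) ?_
    refine hu.continuousOn.comp ?_ fun p hp => hz (add_smul_mem_closedBall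
      (mem_closedBall_zero_iff.1 hp.2) (by simp))
    have : Continuous fun p : ℝ × (Fin d → ℂ) => z + circleMap 0 1 p.1 • p.2 := by fun_prop
    exact this.continuousOn
  have hswap := integral_integral_swap hint
  simp only [hrot] at hswap
  rw [setIntegral_congr_fun (g := fun _ => 2 * Real.pi * u z) Metric.isClosed_closedBall.measurableSet
    fun w hw => integral_circle_line hu hz (mem_closedBall_zero_iff.1 hw), setIntegral_const,
    setIntegral_const, ← htrans, Real.volume_real_Icc_of_le Real.two_pi_pos.le, sub_zero,
    Complex.real_smul, Complex.real_smul] at hswap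
  have hvol : volume.real B = volume.real (Metric.closedBall z r) := by
    simp only [Measure.real, hB]
    rw [Measure.addHaar_closedBall_center volume z r]
  rw [hvol] at hswap
  have hpi : ((2 * Real.pi : ℝ) : ℂ) ≠ 0 := by exact_mod_cast Real.two_pi_pos.ne'
  refine mul_left_cancel₀ hpi (hswap.trans ?_)
  push_cast
  ring

/-- The values of a holomorphic function on a compact set are controlled by its `L²` norm. -/
theorem exists_forall_norm_sq_le (hΩ : IsOpen Ω) {K : Set (Fin d → ℂ)} (hK : IsCompact K)
    (hKΩ : K ⊆ Ω) : ∃ C > 0, ∀ u : (Fin d → ℂ) → ℂ, DifferentiableOn ℂ u Ω →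
      IntegrableOn (fun w => ‖u w‖ ^ 2) Ω → ∀ z ∈ K, ‖u z‖ ^ 2 ≤ C * ∫ w in Ω, ‖u w‖ ^ 2 := by
  obtain ⟨r, hr, hrΩ⟩ := hK.exists_cthickening_subset_open hΩ hKΩ
  have hpos : 0 < volume.real (Metric.closedBall (0 : Fin d → ℂ) r) :=
    ENNReal.toReal_pos (Metric.measure_closedBall_pos _ _ hr).ne'
      (isCompact_closedBall _ _).measure_lt_top.ne
  refine ⟨(volume.real (Metric.closedBall (0 : Fin d → ℂ) r))⁻¹, inv_pos.2 hpos,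
    fun u hu hint z hz => ?_⟩
  have hball : Metric.closedBall z r ⊆ Ω :=
    (Metric.closedBall_subset_cthickening hz r).trans hrΩ
  -- The mean value property of `u²`, instead of `u`, yields the `L²` bound without Cauchy–Schwarz.
  have h := setIntegral_closedBall_eq (u := fun w => u w ^ 2) (hu.pow 2) hball
  have hvol : volume.real (Metric.closedBall z r) =
      volume.real (Metric.closedBall (0 : Fin d → ℂ) r) := by
    simp only [Measure.real]
    rw [Measure.addHaar_closedBall_center volume z r]
  rw [le_inv_mul_iff₀ hpos, ← hvol]
  calc volume.real (Metric.closedBall z r) * ‖u z‖ ^ 2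
      = ‖∫ w in Metric.closedBall z r, u w ^ 2‖ := by
        rw [h, norm_mul, norm_pow, Complex.norm_real, Real.norm_of_nonneg measureReal_nonneg]
    _ ≤ ∫ w in Metric.closedBall z r, ‖u w ^ 2‖ := norm_integral_le_integral_norm _
    _ = ∫ w in Metric.closedBall z r, ‖u w‖ ^ 2 := by simp only [norm_pow]
    _ ≤ ∫ w in Ω, ‖u w‖ ^ 2 := setIntegral_mono_set hint
        (Filter.Eventually.of_forall fun _ => by positivity) hball.eventuallyLE

end Polydisc

end Toeplitz

end

noncomputable section

namespace Toeplitz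

/-! ### The Bergman space as a Hilbert space -/

variable {d : ℕ} {Ω : Set (Fin d → ℂ)}

/-- The inclusion of the Bergman space into `L²(Ω)`. -/
def bergmanToL2 (Ω : Set (Fin d → ℂ)) :
    bergmanSpace Ω →ₗ[ℂ] Lp ℂ 2 (volume.restrict Ω) where
  toFun u := MemLp.toLp u u.2.2.1
  map_add' _ _ := rfl
  map_smul' _ _ := rfl

theorem coeFn_bergmanToL2 (u : bergmanSpace Ω) :
    bergmanToL2 Ω u =ᵐ[volume.restrict Ω] (u : (Fin d → ℂ) → ℂ) := MemLp.coeFn_toLp u.2.2.1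

theorem inner_bergmanToL2 (u v : bergmanSpace Ω) :
    inner ℂ (bergmanToL2 Ω v) (bergmanToL2 Ω u) =
      ∫ w in Ω, (u : (Fin d → ℂ) → ℂ) w * (starRingEnd ℂ) ((v : (Fin d → ℂ) → ℂ) w) := by
  rw [L2.inner_def]
  refine integral_congr_ae ?_
  filter_upwards [coeFn_bergmanToL2 u, coeFn_bergmanToL2 v] with w hu hv
  rw [hu, hv, RCLike.inner_apply]

theorem norm_sq_bergmanToL2 (u : bergmanSpace Ω) :
    ‖bergmanToL2 Ω u‖ ^ 2 = ∫ w in Ω, ‖(u : (Fin d → ℂ) → ℂ) w‖ ^ 2 := by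
  have h := inner_bergmanToL2 u u
  rw [inner_self_eq_norm_sq_to_K] at h
  have e : ∀ w, (u : (Fin d → ℂ) → ℂ) w * (starRingEnd ℂ) ((u : (Fin d → ℂ) → ℂ) w) =
      ((‖(u : (Fin d → ℂ) → ℂ) w‖ ^ 2 : ℝ) : ℂ) := fun w => by
    rw [Complex.mul_conj, Complex.normSq_eq_norm_sq]
  simp only [e, integral_complex_ofReal] at h
  rw [← RCLike.ofReal_pow] at h
  exact Complex.ofReal_injective h

theorem exists_forall_norm_le (hΩ : IsOpen Ω) {K : Set (Fin d → ℂ)} (hK : IsCompact K)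
    (hKΩ : K ⊆ Ω) : ∃ C > 0, ∀ u : bergmanSpace Ω, ∀ z ∈ K,
      ‖(u : (Fin d → ℂ) → ℂ) z‖ ≤ C * ‖bergmanToL2 Ω u‖ := by
  obtain ⟨C, hC, h⟩ := exists_forall_norm_sq_le hΩ hK hKΩ
  refine ⟨√C, Real.sqrt_pos.2 hC, fun u z hz => ?_⟩
  have h1 := h u u.2.1 (u.2.2.1.integrable_norm_pow (by norm_num)) z hz
  rw [← norm_sq_bergmanToL2] at h1
  refine le_of_sq_le_sq ?_ (by positivity)
  rwa [mul_pow, Real.sq_sqrt hC.le]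

theorem bergmanToL2_injective (hΩ : IsOpen Ω) : Function.Injective (bergmanToL2 Ω) := by
  intro u v huv
  have hae : (u : (Fin d → ℂ) → ℂ) =ᵐ[volume.restrict Ω] v := by
    refine (coeFn_bergmanToL2 u).symm.trans ?_
    rw [huv]
    exact coeFn_bergmanToL2 v
  have hE := Measure.eqOn_open_of_ae_eq hae hΩ u.2.1.continuousOn v.2.1.continuousOn
  refine Subtype.ext (funext fun w => ?_)
  by_cases hw : w ∈ Ω
  · exact hE hw
  · rw [u.2.2.2 w hw, v.2.2.2 w hw]

/-- By `exists_forall_norm_le` an `L²` Cauchy sequence converges locally uniformly, so its pointwise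
limit is holomorphic; an a.e. convergent subsequence identifies it with the `L²` limit. -/
theorem isClosed_range_bergmanToL2 (hΩ : IsOpen Ω) :
    IsClosed (LinearMap.range (bergmanToL2 Ω) : Set (Lp ℂ 2 (volume.restrict Ω))) := by
  classical
  refine IsSeqClosed.isClosed fun F f hF hlim => ?_
  choose u hu using hF
  have hcauchy : ∀ K : Set (Fin d → ℂ), IsCompact K → K ⊆ Ω →
      UniformCauchySeqOn (fun n => (u n : (Fin d → ℂ) → ℂ)) Filter.atTop K := by
    intro K hK hKΩ
    obtain ⟨C, hC, hle⟩ := exists_forall_norm_le hΩ hK hKΩ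
    rw [Metric.uniformCauchySeqOn_iff]
    intro ε hε
    obtain ⟨N, hN⟩ := Metric.cauchySeq_iff.1 hlim.cauchySeq (ε / C) (by positivity)
    refine ⟨N, fun m hm n hn z hz => ?_⟩
    have h1 := hle (u m - u n) z hz
    have h2 := hN m hm n hn
    rw [map_sub, hu, hu, ← dist_eq_norm] at h1
    rw [lt_div_iff₀ hC, mul_comm] at h2
    rw [dist_eq_norm]
    exact h1.trans_lt h2
  have hpt : ∀ z, ∃ a : ℂ, z ∈ Ω →
      Filter.Tendsto (fun n => (u n : (Fin d → ℂ) → ℂ) z) Filter.atTop (nhds a) := by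
    intro z
    by_cases hz : z ∈ Ω
    · obtain ⟨a, ha⟩ := cauchySeq_tendsto_of_complete
        ((hcauchy {z} isCompact_singleton (singleton_subset_iff.2 hz)).cauchySeq rfl)
      exact ⟨a, fun _ => ha⟩
    · exact ⟨0, fun h => absurd h hz⟩
  choose v hv using hpt
  have hvd : DifferentiableOn ℂ v Ω := by
    refine differentiableOn_of_forall_exists_uniformCauchySeqOn hΩ (fun n => (u n).2.1)
      (fun z hz => ?_) hv
    obtain ⟨r, hr, hrΩ⟩ := Metric.nhds_basis_closedBall.mem_iff.1 (hΩ.mem_nhds hz)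
    exact ⟨r, hr, hrΩ, hcauchy _ (isCompact_closedBall _ _) hrΩ⟩
  have hae : f =ᵐ[volume.restrict Ω] Ω.indicator v := by
    obtain ⟨ns, hns, hae⟩ := (tendstoInMeasure_of_tendsto_Lp hlim).exists_seq_tendsto_ae
    have hall : ∀ᵐ w ∂(volume.restrict Ω), ∀ n, F n w = (u n : (Fin d → ℂ) → ℂ) w := by
      rw [ae_all_iff]
      intro n
      rw [← hu n]
      exact coeFn_bergmanToL2 (u n)
    filter_upwards [hae, hall, ae_restrict_mem hΩ.measurableSet] with w h1 h2 h3
    rw [indicator_of_mem h3]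
    simp only [h2] at h1
    exact tendsto_nhds_unique h1 ((hv w h3).comp hns.tendsto_atTop)
  have hmem : Ω.indicator v ∈ bergmanSpace Ω := by
    refine ⟨hvd.congr fun z hz => indicator_of_mem hz v, (Lp.memLp f).ae_eq hae,
      fun z hz => indicator_of_notMem hz v⟩
  refine ⟨⟨_, hmem⟩, Lp.ext ?_⟩
  exact (coeFn_bergmanToL2 _).trans hae.symm

/-- The Riesz representation theorem in the Bergman space. -/
theorem exists_forall_eq_integral (hΩ : IsOpen Ω) (φ : bergmanSpace Ω →ₗ[ℂ] ℂ) {C : ℝ}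
    (hφ : ∀ u, ‖φ u‖ ≤ C * ‖bergmanToL2 Ω u‖) : ∃ k : bergmanSpace Ω, ∀ u : bergmanSpace Ω,
      φ u = ∫ w in Ω, (u : (Fin d → ℂ) → ℂ) w * (starRingEnd ℂ) ((k : (Fin d → ℂ) → ℂ) w) := by
  -- The functional is transported to the image in `L²`, a Hilbert space because it is closed.
  let e := LinearEquiv.ofInjective (bergmanToL2 Ω) (bergmanToL2_injective hΩ)
  have he : ∀ u, ((e u : LinearMap.range (bergmanToL2 Ω)) : Lp ℂ 2 (volume.restrict Ω)) =
      bergmanToL2 Ω u := fun u => rfl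
  have : CompleteSpace (LinearMap.range (bergmanToL2 Ω)) :=
    (isClosed_range_bergmanToL2 hΩ).completeSpace_coe
  let ψ : LinearMap.range (bergmanToL2 Ω) →L[ℂ] ℂ :=
    (φ ∘ₗ (e.symm : LinearMap.range (bergmanToL2 Ω) →ₗ[ℂ] bergmanSpace Ω)).mkContinuous C
      fun x => by
        have := hφ (e.symm x)
        rw [← he, LinearEquiv.apply_symm_apply] at this
        exact this
  refine ⟨e.symm ((InnerProductSpace.toDual ℂ _).symm ψ), fun u => ?_⟩
  rw [← inner_bergmanToL2, ← he, ← he, LinearEquiv.apply_symm_apply, ← Submodule.coe_inner,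
    InnerProductSpace.toDual_symm_apply]
  change φ u = φ (e.symm (e u))
  rw [LinearEquiv.symm_apply_apply]

theorem exists_isReproducingAt (hΩ : IsOpen Ω) {z : Fin d → ℂ} (hz : z ∈ Ω) :
    ∃ k, IsReproducingAt Ω z k := by
  obtain ⟨C, -, hC⟩ := exists_forall_norm_le hΩ isCompact_singleton (singleton_subset_iff.2 hz)
  obtain ⟨k, hk⟩ := exists_forall_eq_integral hΩ
    ((LinearMap.proj z).comp (bergmanSpace Ω).subtype) fun u => hC u z rfl
  exact ⟨k, k.2, fun u hu => hk ⟨u, hu⟩⟩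

theorem isReproducingAt_reproducingElement (hΩ : IsOpen Ω) {z : Fin d → ℂ} (hz : z ∈ Ω) :
    IsReproducingAt Ω z (reproducingElement Ω z) := by
  have h := exists_isReproducingAt hΩ hz
  rw [reproducingElement, dif_pos h]
  exact h.choose_spec

/-! ### Toeplitz–Bergman operators -/

/-- A function whose Toeplitz–Bergman transform vanishes is orthogonal, with respect to `μ`, to the
whole Bergman space. -/
theorem cintegral_mul_conj_eq_zero (hΩ : IsOpen Ω) {μ : ComplexMeasure (Fin d → ℂ)}
    (hμ : HasCompactSupportIn μ Ω) {u : (Fin d → ℂ) → ℂ} (hu : ContinuousOn u Ω)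
    (h0 : ∀ z ∈ Ω, cintegral μ (fun w => u w * bergmanKernel Ω z w) = 0) {g : (Fin d → ℂ) → ℂ}
    (hg : g ∈ bergmanSpace Ω) : cintegral μ (fun w => u w * (starRingEnd ℂ) (g w)) = 0 := by
  have := isFiniteMeasure_variation μ
  obtain ⟨K, hK, hKΩ, hνK⟩ := exists_isCompact_ae_mem hμ
  obtain ⟨C, hC0, hC⟩ := exists_forall_norm_le hΩ hK hKΩ
  obtain ⟨D, hD⟩ := hK.exists_bound_of_continuousOn (hu.mono hKΩ)
  have hint : ∀ g : bergmanSpace Ω, Integrable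
      (fun w => u w * (starRingEnd ℂ) ((g : (Fin d → ℂ) → ℂ) w)) μ.variation := fun g =>
    integrable_of_continuousOn hμ (hu.mul (Complex.continuous_conj.comp_continuousOn
      g.2.1.continuousOn))
  -- The outer conjugation makes the pairing linear in `g`; it is bounded because `μ` lives on a
  -- compact set, where values are controlled by the `L²` norm.
  let φ : bergmanSpace Ω →ₗ[ℂ] ℂ :=
    { toFun := fun g => (starRingEnd ℂ)
        (cintegral μ fun w => u w * (starRingEnd ℂ) ((g : (Fin d → ℂ) → ℂ) w))
      map_add' := fun f g => by
        have e : (fun w => u w * (starRingEnd ℂ) (((f + g : bergmanSpace Ω) :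
            (Fin d → ℂ) → ℂ) w)) = fun w => u w * (starRingEnd ℂ) ((f : (Fin d → ℂ) → ℂ) w) +
              u w * (starRingEnd ℂ) ((g : (Fin d → ℂ) → ℂ) w) := by
          funext w
          simp [mul_add]
        rw [e, cintegral_add μ (hint f) (hint g), map_add]
      map_smul' := fun c g => by
        have e : (fun w => u w * (starRingEnd ℂ) (((c • g : bergmanSpace Ω) :
            (Fin d → ℂ) → ℂ) w)) = fun w => (starRingEnd ℂ) c *
              (u w * (starRingEnd ℂ) ((g : (Fin d → ℂ) → ℂ) w)) := by
          funext w
          simp only [Submodule.coe_smul, Pi.smul_apply, smul_eq_mul, map_mul]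
          ring
        rw [e, cintegral_const_mul, map_mul, Complex.conj_conj]
        rfl }
  have hφ : ∀ g, ‖φ g‖ ≤ D * C * μ.variation.real univ * ‖bergmanToL2 Ω g‖ := by
    intro g
    change ‖(starRingEnd ℂ) (cintegral μ fun w => u w *
      (starRingEnd ℂ) ((g : (Fin d → ℂ) → ℂ) w))‖ ≤ _
    rw [RCLike.norm_conj, cintegral_eq_integral μ (hint g)]
    have hbound : ∀ᵐ w ∂μ.variation, ‖u w * (starRingEnd ℂ) ((g : (Fin d → ℂ) → ℂ) w) *
        μ.rnDeriv μ.variation w‖ ≤ D * (C * ‖bergmanToL2 Ω g‖) := by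
      filter_upwards [hνK, norm_rnDeriv_variation μ] with w hw hρ
      rw [norm_mul, hρ, mul_one, norm_mul, RCLike.norm_conj]
      exact mul_le_mul (hD w hw) (hC g w hw) (norm_nonneg _) ((norm_nonneg _).trans (hD w hw))
    refine (norm_integral_le_of_norm_le_const hbound).trans (le_of_eq ?_)
    ring
  obtain ⟨h, hh⟩ := exists_forall_eq_integral hΩ φ hφ
  -- The hypothesis says `φ` vanishes at the reproducing element `k_z`, and `φ k_z = ⟨k_z, h⟩` is
  -- the conjugate of `h z`.
  have hh0 : (h : (Fin d → ℂ) → ℂ) = 0 := by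
    funext z
    by_cases hz : z ∈ Ω
    · have hk := isReproducingAt_reproducingElement hΩ hz
      have h1 : φ ⟨_, hk.1⟩ = 0 := by
        change (starRingEnd ℂ) (cintegral μ fun w => u w * bergmanKernel Ω z w) = 0
        rw [h0 z hz, map_zero]
      rw [hh] at h1
      rw [hk.2 h h.2]
      have h2 := congrArg (starRingEnd ℂ) h1
      rw [← integral_conj, map_zero] at h2
      rw [Pi.zero_apply, ← h2]
      refine integral_congr_ae (Filter.Eventually.of_forall fun w => ?_)
      simp [mul_comm]
    · exact h.2.2.2 z hz
  have h1 := hh ⟨g, hg⟩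
  simp only [hh0, Pi.zero_apply, map_zero, mul_zero, integral_zero] at h1
  exact (map_eq_zero (starRingEnd ℂ)).1 h1

theorem indicator_mem_bergmanSpace (hΩ : IsOpen Ω) (hb : Bornology.IsBounded Ω)
    {f : (Fin d → ℂ) → ℂ} (hf : Differentiable ℂ f) : Ω.indicator f ∈ bergmanSpace Ω := by
  refine ⟨hf.differentiableOn.congr fun z hz => indicator_of_mem hz f, ?_,
    fun z hz => indicator_of_notMem hz f⟩
  have : IsFiniteMeasure (volume.restrict Ω) := ⟨by
    rw [Measure.restrict_apply_univ]
    exact hb.measure_lt_top⟩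
  obtain ⟨C, hC⟩ := hb.isCompact_closure.exists_bound_of_continuousOn hf.continuous.continuousOn
  refine MemLp.of_bound (hf.continuous.stronglyMeasurable.indicator
    hΩ.measurableSet).aestronglyMeasurable C ?_
  filter_upwards [ae_restrict_mem hΩ.measurableSet] with w hw
  rw [indicator_of_mem hw]
  exact hC w (subset_closure hw)

theorem isCombOfPointMasses_of_rank_toeplitzBergman (hΩ : IsOpen Ω) (hb : Bornology.IsBounded Ω)
    {μ : ComplexMeasure (Fin d → ℂ)} (hμ : HasCompactSupportIn μ Ω) {N : ℕ}
    (hN : (toeplitzBergman Ω μ hμ).rank = N) : IsCombOfPointMasses N Ω μ := by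
  refine isCombOfPointMasses_of_rank_eq (A := expAlgebra d) _ hμ
    (fun x y => exists_expAlgebra_ne)
    (fun f hf => (differentiable_of_mem_expAlgebra hf).continuous)
    (fun f hf => indicator_mem_bergmanSpace hΩ hb (differentiable_of_mem_expAlgebra hf))
    (fun u hu h0 g hg => ?_) hN
  have h := cintegral_mul_conj_eq_zero hΩ hμ hu.1.continuousOn (fun z _ => h0 z)
    (indicator_mem_bergmanSpace hΩ hb (differentiable_of_mem_expAlgebra hg))
  obtain ⟨K, -, hKΩ, hνK⟩ := exists_isCompact_ae_mem hμ
  rw [← h]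
  -- Cutting `g` off outside `Ω` is invisible to `μ`, which is carried by `K ⊆ Ω`.
  refine VectorMeasure.integral_congr_ae ?_
  filter_upwards [hνK] with w hw
  rw [indicator_of_mem (hKΩ hw)]

end Toeplitz

end

theorem theorem1 (d : ℕ) (hd : 1 ≤ d) :
    (∀ (μ : ComplexMeasure (Fin d → ℂ)) (hμ : Toeplitz.HasCompactSupportIn μ univ) (N : ℕ),
      (Toeplitz.toeplitzBargmann μ hμ).rank = (N : Cardinal) →
        Toeplitz.IsCombOfPointMasses N univ μ ∧
        (VectorMeasure.AbsolutelyContinuous μ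
          (volume : Measure (Fin d → ℂ)).toENNRealVectorMeasure → μ = 0)) ∧
    (∀ (Ω : Set (Fin d → ℂ)), IsOpen Ω → IsConnected Ω → Bornology.IsBounded Ω →
      ∀ (μ : ComplexMeasure (Fin d → ℂ)) (hμ : Toeplitz.HasCompactSupportIn μ Ω) (N : ℕ),
      (Toeplitz.toeplitzBergman Ω μ hμ).rank = (N : Cardinal) →
        Toeplitz.IsCombOfPointMasses N Ω μ ∧
        (VectorMeasure.AbsolutelyContinuous μ
          (volume : Measure (Fin d → ℂ)).toENNRealVectorMeasure → μ = 0)) := by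
  refine ⟨fun μ hμ N hN => ?_, fun Ω hΩ _ hb μ hμ N hN => ?_⟩
  · have h := Toeplitz.isCombOfPointMasses_of_rank_toeplitzBargmann hμ hN
    exact ⟨h, h.eq_zero_of_absolutelyContinuous hd⟩
  · have h := Toeplitz.isCombOfPointMasses_of_rank_toeplitzBergman hΩ hb hμ hN
    exact ⟨h, h.eq_zero_of_absolutelyContinuous hd⟩
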